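/- Let $\mathbb H^n=\mathbb R^{2n+1}$ be the Heisenberg group with coordinates $(x,y,t)$ and contact form $\theta=dt-\frac12\sum_{j=1}^n(x_j\,dy_j-y_j\,dx_j)$. Let $n+1\le k\le 2n+1$ and $h=2n+1-k$. Let $U\subset\mathbb H^n$ be open, let $f:U\to\mathbb R^h$ be a smooth map such that for every $p\in U$ the restriction of $df_p$ to the contact hyperplane $\ker\theta_p$ is onto $\mathbb R^h$, and let $\Phi:\mathbb R^h\to\mathbb R$ be smooth. Orient each level set $f^{-1}(y)$ as a fibre of $f$: a frame of $\ker df_p$ is positive if, preceded by vectors of $\mathbb R^{2n+1}$ that $df_p$ maps to the standard basis of $\mathbb R^h$, it gives a positive frame of $\mathbb R^{2n+1}$. Then the formula $$\langle T_{f,\Phi},\omega\rangle=\int_{\mathbb R^h}\Big(\int_{f^{-1}(y)}\omega\Big)\Phi(y)\,dy,$$ for compactly supported smooth $k$-forms $\omega$ on $U$, is well defined (every inner integral is well defined and the outer integrand is integrable) and gives a $k$-dimensional current on $U$, i.e. a continuous linear functional on such forms. Moreover $T_{f,\Phi}$ is oblique if and only if for every $y\in\mathbb R^h$ with $\Phi(y)\ne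 0$ the level set $f^{-1}(y)$ is a co-Legendrian submanifold. (In particular, if $\Phi$ vanishes nowhere, $T_{f,\Phi}$ is oblique if and only if all level sets of $f$ are co-Legendrian.) Here a $k$-dimensional current $T$ is oblique if $T\llcorner(\theta\wedge(d\theta)^{k-n})=0$ and $\partial T\llcorner(\theta\wedge(d\theta)^{k-n-1})=0$, where $\langle T\llcorner\varphi,\omega\rangle=\langle T,\varphi\wedge\omega\rangle$ (and $T\llcorner\varphi=0$ if $\deg\varphi>\dim T$) and $\langle\partial T,\omega\rangle=\langle T,d\omega\rangle$. A $k$-dimensional submanifold $M$ of $\mathbb H^n$ is co-Legendrian if for every $p\in M$ the subspace $T_pM\cap\ker\theta_p$ is coisotropic in $(\ker\theta_p,d\theta_p)$, i.e. contains its $d\theta_p$-orthogonal complement in $\ker\theta_p$. -/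

import Mathlib

open MeasureTheory Set Filter Topology
open scoped ContDiff Nat

noncomputable section

namespace Heisenberg

/-! ### Exterior algebra -/

section Wedge

variable {E : Type*} [NormedAddCommGroup E] [NormedSpace ℝ E]

/-- The tensor product `(α ⊗ β)(v₁, …, v_c) = α(v₁, …, v_a) β(v_{a+1}, …, v_c)`, `c = a + b`. -/
def tensor {a b c : ℕ} (h : a + b = c) (α : E [⋀^Fin a]→L[ℝ] ℝ) (β : E [⋀^Fin b]→L[ℝ] ℝ) :
    ContinuousMultilinearMap ℝ (fun _ : Fin c => E) ℝ where
  toFun v := α (fun i => v (Fin.cast h (Fin.castAdd b i))) *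
    β (fun i => v (Fin.cast h (Fin.natAdd a i)))
  map_update_add' v i x y := by
    subst h
    simp only [Fin.cast_eq_self]
    refine Fin.addCases (fun i => ?_) (fun i => ?_) i
    · have key : ∀ z : E, (fun j => Function.update v (Fin.castAdd b i) z (Fin.castAdd b j)) =
          Function.update (fun j => v (Fin.castAdd b j)) i z := fun z => by
        ext1 j; by_cases hj : j = i <;> simp [hj]
      have key' : ∀ z : E, (fun j => Function.update v (Fin.castAdd b i) z (Fin.natAdd a j)) =
          (fun j => v (Fin.natAdd a j)) := fun z => by
        ext1 j; rw [Function.update_of_ne]; simp [Fin.ext_iff]; omega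
      simp only [key, key', ContinuousAlternatingMap.map_update_add, add_mul]
    · have key : ∀ z : E, (fun j => Function.update v (Fin.natAdd a i) z (Fin.natAdd a j)) =
          Function.update (fun j => v (Fin.natAdd a j)) i z := fun z => by
        ext1 j; by_cases hj : j = i <;> simp [hj]
      have key' : ∀ z : E, (fun j => Function.update v (Fin.natAdd a i) z (Fin.castAdd b j)) =
          (fun j => v (Fin.castAdd b j)) := fun z => by
        ext1 j; rw [Function.update_of_ne]; simp [Fin.ext_iff]; omega
      simp only [key, key', ContinuousAlternatingMap.map_update_add, mul_add]
  map_update_smul' v i r x := by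
    subst h
    simp only [Fin.cast_eq_self]
    refine Fin.addCases (fun i => ?_) (fun i => ?_) i
    · have key : ∀ z : E, (fun j => Function.update v (Fin.castAdd b i) z (Fin.castAdd b j)) =
          Function.update (fun j => v (Fin.castAdd b j)) i z := fun z => by
        ext1 j; by_cases hj : j = i <;> simp [hj]
      have key' : ∀ z : E, (fun j => Function.update v (Fin.castAdd b i) z (Fin.natAdd a j)) =
          (fun j => v (Fin.natAdd a j)) := fun z => by
        ext1 j; rw [Function.update_of_ne]; simp [Fin.ext_iff]; omega
      simp only [key, key', ContinuousAlternatingMap.map_update_smul, smul_eq_mul, mul_assoc]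
    · have key : ∀ z : E, (fun j => Function.update v (Fin.natAdd a i) z (Fin.natAdd a j)) =
          Function.update (fun j => v (Fin.natAdd a j)) i z := fun z => by
        ext1 j; by_cases hj : j = i <;> simp [hj]
      have key' : ∀ z : E, (fun j => Function.update v (Fin.natAdd a i) z (Fin.castAdd b j)) =
          (fun j => v (Fin.castAdd b j)) := fun z => by
        ext1 j; rw [Function.update_of_ne]; simp [Fin.ext_iff]; omega
      simp only [key, key', ContinuousAlternatingMap.map_update_smul, smul_eq_mul]
      ring
  cont := by
    refine Continuous.mul ?_ ?_
    · exact α.cont.comp (by fun_prop)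
    · exact β.cont.comp (by fun_prop)

/-- The wedge product (determinant convention)
`(α ∧ β)(v) = 1 / (a! b!) ∑_σ sign σ • α(v_{σ 1}, …, v_{σ a}) β(v_{σ (a+1)}, …, v_{σ (a+b)})`.
The degree `c = a + b` of the result is a parameter, to avoid casts. -/
def wedge {a b c : ℕ} (h : a + b = c) (α : E [⋀^Fin a]→L[ℝ] ℝ) (β : E [⋀^Fin b]→L[ℝ] ℝ) :
    E [⋀^Fin c]→L[ℝ] ℝ :=
  ((a ! : ℝ) * (b ! : ℝ))⁻¹ • ContinuousMultilinearMap.alternatization (tensor h α β)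

theorem wedge_apply {a b c : ℕ} (h : a + b = c) (α : E [⋀^Fin a]→L[ℝ] ℝ)
    (β : E [⋀^Fin b]→L[ℝ] ℝ) (v : Fin c → E) :
    wedge h α β v = ((a ! : ℝ) * (b ! : ℝ))⁻¹ * ∑ σ : Equiv.Perm (Fin c),
      ((Equiv.Perm.sign σ : ℤ) : ℝ) * (α (fun i => v (σ (Fin.cast h (Fin.castAdd b i)))) *
        β (fun i => v (σ (Fin.cast h (Fin.natAdd a i))))) := by
  simp only [wedge, ContinuousAlternatingMap.smul_apply, smul_eq_mul,
    ContinuousMultilinearMap.alternatization_apply_apply]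
  congr 1
  refine Finset.sum_congr rfl fun σ _ => ?_
  rw [Units.smul_def, zsmul_eq_mul]
  rfl

theorem norm_wedge_le {a b c : ℕ} (h : a + b = c) (α : E [⋀^Fin a]→L[ℝ] ℝ)
    (β : E [⋀^Fin b]→L[ℝ] ℝ) :
    ‖wedge h α β‖ ≤ (((a ! : ℝ) * (b ! : ℝ))⁻¹ * (c ! : ℝ)) * ‖α‖ * ‖β‖ := by
  refine ContinuousAlternatingMap.opNorm_le_bound _ (by positivity) fun v => ?_
  rw [wedge_apply, norm_mul, Real.norm_of_nonneg (by positivity), mul_assoc, mul_assoc, mul_assoc]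
  refine mul_le_mul_of_nonneg_left ?_ (by positivity)
  refine (norm_sum_le _ _).trans ?_
  have hb : ∀ σ ∈ (Finset.univ : Finset (Equiv.Perm (Fin c))),
      ‖((Equiv.Perm.sign σ : ℤ) : ℝ) * (α (fun i => v (σ (Fin.cast h (Fin.castAdd b i)))) *
        β (fun i => v (σ (Fin.cast h (Fin.natAdd a i)))))‖ ≤ ‖α‖ * (‖β‖ * ∏ i, ‖v i‖) := by
    intro σ _
    have hs : ‖((Equiv.Perm.sign σ : ℤ) : ℝ)‖ = 1 := by
      rcases Int.units_eq_one_or (Equiv.Perm.sign σ) with h1 | h1 <;> simp [h1]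
    rw [norm_mul, hs, one_mul, norm_mul]
    refine (mul_le_mul (α.le_opNorm _) (β.le_opNorm _) (norm_nonneg _) (by positivity)).trans ?_
    subst h
    rw [← Equiv.prod_comp σ (fun i => ‖v i‖), Fin.prod_univ_add]
    simp only [Fin.cast_eq_self]
    apply le_of_eq
    ring
  refine (Finset.sum_le_card_nsmul _ _ _ hb).trans ?_
  rw [Finset.card_univ, Fintype.card_perm, Fintype.card_fin, nsmul_eq_mul]

/-- The wedge product as a continuous bilinear map. -/
def wedgeL {a b c : ℕ} (h : a + b = c) :
    (E [⋀^Fin a]→L[ℝ] ℝ) →L[ℝ] (E [⋀^Fin b]→L[ℝ] ℝ) →L[ℝ] (E [⋀^Fin c]→L[ℝ] ℝ) :=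
  LinearMap.mkContinuous₂
    (LinearMap.mk₂ ℝ (wedge h)
      (fun α α' β => by
        ext v; simp only [wedge_apply, ContinuousAlternatingMap.add_apply, add_mul, mul_add,
          Finset.sum_add_distrib])
      (fun r α β => by
        ext v
        simp only [wedge_apply, ContinuousAlternatingMap.smul_apply, smul_eq_mul, Finset.mul_sum]
        exact Finset.sum_congr rfl fun σ _ => by ring)
      (fun α β β' => by
        ext v; simp only [wedge_apply, ContinuousAlternatingMap.add_apply, mul_add,
          Finset.sum_add_distrib])
      (fun r α β => by
        ext v
        simp only [wedge_apply, ContinuousAlternatingMap.smul_apply, smul_eq_mul, Finset.mul_sum]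
        exact Finset.sum_congr rfl fun σ _ => by ring))
    (((a ! : ℝ) * (b ! : ℝ))⁻¹ * (c ! : ℝ)) (fun α β => norm_wedge_le h α β)

theorem wedgeL_apply {a b c : ℕ} (h : a + b = c) (α : E [⋀^Fin a]→L[ℝ] ℝ)
    (β : E [⋀^Fin b]→L[ℝ] ℝ) : wedgeL h α β = wedge h α β := rfl

theorem support_wedge_subset {a b c : ℕ} (h : a + b = c) (χ : E → E [⋀^Fin a]→L[ℝ] ℝ)
    (η : E → E [⋀^Fin b]→L[ℝ] ℝ) :
    Function.support (fun p => wedge h (χ p) (η p)) ⊆ Function.support η := fun p hp hη =>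
  hp (show wedgeL h (χ p) (η p) = 0 by rw [hη, map_zero])

theorem contDiff_wedge {a b c : ℕ} (h : a + b = c) {χ : E → E [⋀^Fin a]→L[ℝ] ℝ}
    {η : E → E [⋀^Fin b]→L[ℝ] ℝ} (hχ : ContDiff ℝ ∞ χ) (hη : ContDiff ℝ ∞ η) :
    ContDiff ℝ ∞ (fun p => wedge h (χ p) (η p)) := by
  have h0 : ContDiff ℝ ∞ (fun α : E [⋀^Fin a]→L[ℝ] ℝ => wedgeL (b := b) h α) := by
    apply ContinuousLinearMap.contDiff
  have h1 : ContDiff ℝ ∞ (fun p => wedgeL (E := E) h (χ p)) := h0.comp hχ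
  exact h1.clm_apply hη

theorem contDiff_extDeriv {a : ℕ} {χ : E → E [⋀^Fin a]→L[ℝ] ℝ} (hχ : ContDiff ℝ ∞ χ) :
    ContDiff ℝ ∞ (extDeriv χ) :=
  (ContinuousAlternatingMap.alternatizeUncurryFinCLM ℝ E ℝ).contDiff.comp
    (hχ.fderiv_right (by simp))

end Wedge

/-! ### Currents -/

section Currents

variable {E : Type*} [NormedAddCommGroup E] [NormedSpace ℝ E]

/-- `𝒟^k(U)`: smooth `k`-forms with compact support in the open set `U`, with the canonical
locally convex topology. -/
abbrev TestForm (U : TopologicalSpace.Opens E) (k : ℕ) : Type _ :=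
  TestFunction U (E [⋀^Fin k]→L[ℝ] ℝ) (⊤ : ℕ∞)

/-- `𝒟_k(U)`: Federer-Fleming `k`-currents on `U`, the topological dual of `𝒟^k(U)`. -/
abbrev Current (U : TopologicalSpace.Opens E) (k : ℕ) : Type _ := TestForm U k →L[ℝ] ℝ

variable {U : TopologicalSpace.Opens E}

/-- The exterior derivative `d : 𝒟^k(U) → 𝒟^{k+1}(U)`. -/
def TestForm.d {k : ℕ} : TestForm U k →L[ℝ] TestForm U (k + 1) :=
  (TestFunction.postcompCLM (ContinuousAlternatingMap.alternatizeUncurryFinCLM ℝ E ℝ)).comp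
    (TestFunction.fderivCLM ℝ ⊤ ⊤)

theorem TestForm.d_apply {k : ℕ} (η : TestForm U k) (p : E) :
    TestForm.d η p = extDeriv (fun q => η q) p := by
  simp only [TestForm.d, ContinuousLinearMap.comp_apply, TestFunction.postcompCLM_apply,
    Function.comp_apply]
  rw [TestFunction.fderivCLM_apply_of_le η (by simp)]
  rfl

/-- The product `χ ∧ η` of a smooth form `χ` with a compactly supported form `η`. -/
def TestForm.wedgeLeft {a b c : ℕ} (h : a + b = c) (χ : E → E [⋀^Fin a]→L[ℝ] ℝ)
    (hχ : ContDiff ℝ ∞ χ) (η : TestForm U b) : TestForm U c where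
  toFun p := wedge h (χ p) (η p)
  contDiff' := contDiff_wedge h hχ η.contDiff
  hasCompactSupport' := η.hasCompactSupport.mono (support_wedge_subset h χ η)
  tsupport_subset' := (closure_mono (support_wedge_subset h χ η)).trans η.tsupport_subset

/-- The boundary `⟨∂T, η⟩ = ⟨T, dη⟩`; the boundary of a `0`-current is zero. -/
def Current.boundary : {k : ℕ} → Current U k → Current U (k - 1)
  | 0, _ => 0
  | _ + 1, T => T.comp TestForm.d

/-- `T ⌞ χ = 0`, where `⟨T ⌞ χ, η⟩ = ⟨T, χ ∧ η⟩` for test forms `η` of degree `k - deg χ`.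
(If `deg χ > k` then `T ⌞ χ` is zero.) -/
def Current.RestrictEqZero {k a : ℕ} (T : Current U k) (χ : E → E [⋀^Fin a]→L[ℝ] ℝ)
    (hχ : ContDiff ℝ ∞ χ) : Prop :=
  ∀ (b : ℕ) (h : a + b = k) (η : TestForm U b), T (TestForm.wedgeLeft h χ hχ η) = 0

end Currents

/-! ### The Heisenberg group and its contact structure -/

/-- The Heisenberg group `ℍⁿ` in exponential coordinates `(x₁, …, xₙ, y₁, …, yₙ, t)`. -/
abbrev Heis (n : ℕ) : Type := EuclideanSpace ℝ (Fin (2 * n + 1))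

/-- Index of the coordinate `x_j`. -/
def ix {n : ℕ} (j : Fin n) : Fin (2 * n + 1) := ⟨j, by omega⟩

/-- Index of the coordinate `y_j`. -/
def iy {n : ℕ} (j : Fin n) : Fin (2 * n + 1) := ⟨n + j, by omega⟩

/-- The covector `θ_p = dt - 1/2 ∑_j (x_j dy_j - y_j dx_j)`. -/
def contactCovector (n : ℕ) (p : Heis n) : Heis n →L[ℝ] ℝ :=
  EuclideanSpace.proj (Fin.last (2 * n)) - (1 / 2 : ℝ) • ∑ j : Fin n,
    (p (ix j) • (EuclideanSpace.proj (iy j) : Heis n →L[ℝ] ℝ) -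
      p (iy j) • (EuclideanSpace.proj (ix j) : Heis n →L[ℝ] ℝ))

/-- The contact form `θ`, as a differential 1-form. -/
def contactForm (n : ℕ) (p : Heis n) : Heis n [⋀^Fin 1]→L[ℝ] ℝ :=
  ContinuousAlternatingMap.ofSubsingleton ℝ (Heis n) ℝ (0 : Fin 1) (contactCovector n p)

/-- The 2-form `dθ`. -/
def dContactForm (n : ℕ) : Heis n → Heis n [⋀^Fin 2]→L[ℝ] ℝ := extDeriv (contactForm n)

/-- The form `(dθ)^m`. -/
def dContactPow (n : ℕ) : (m : ℕ) → Heis n → Heis n [⋀^Fin (2 * m)]→L[ℝ] ℝ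
  | 0 => fun _ => ContinuousAlternatingMap.constOfIsEmpty ℝ (Heis n) (Fin 0) (1 : ℝ)
  | m + 1 => fun p => wedge (by ring) (dContactForm n p) (dContactPow n m p)

/-- The form `θ ∧ (dθ)^m`. -/
def contactPow (n m : ℕ) (p : Heis n) : Heis n [⋀^Fin (1 + 2 * m)]→L[ℝ] ℝ :=
  wedge rfl (contactForm n p) (dContactPow n m p)

theorem contDiff_contactForm (n : ℕ) : ContDiff ℝ ∞ (contactForm n) := by
  have h : ContDiff ℝ ∞ (contactCovector n) := by
    unfold contactCovector
    fun_prop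
  exact (ContinuousAlternatingMap.ofSubsingletonLIE (𝕜 := ℝ) (E := Heis n) (F := ℝ)
    (0 : Fin 1)).contDiff.comp h

theorem contDiff_dContactPow (n : ℕ) : ∀ m, ContDiff ℝ ∞ (dContactPow n m)
  | 0 => contDiff_const
  | m + 1 => contDiff_wedge _ (contDiff_extDeriv (contDiff_contactForm n))
      (contDiff_dContactPow n m)

theorem contDiff_contactPow (n m : ℕ) : ContDiff ℝ ∞ (contactPow n m) :=
  contDiff_wedge _ (contDiff_contactForm n) (contDiff_dContactPow n m)

/-- A `k`-current `T` is co-Legendrian if `T ⌞ (θ ∧ (dθ)^{k-n}) = 0`. -/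
def IsCoLegendrianCurrent {n : ℕ} {U : TopologicalSpace.Opens (Heis n)} {k : ℕ}
    (T : Current U k) : Prop :=
  Current.RestrictEqZero T (contactPow n (k - n)) (contDiff_contactPow n (k - n))

/-- A `k`-current `T`, `k ≥ n + 1`, is oblique if `T` and `∂T` are co-Legendrian, i.e.
`T ⌞ (θ ∧ (dθ)^{k-n}) = 0` and `∂T ⌞ (θ ∧ (dθ)^{k-1-n}) = 0`. -/
def IsOblique {n : ℕ} {U : TopologicalSpace.Opens (Heis n)} {k : ℕ} (T : Current U k) : Prop :=
  IsCoLegendrianCurrent T ∧ IsCoLegendrianCurrent (Current.boundary T)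

/-! ### Submanifolds and integration of forms -/

section Submanifold

variable {E : Type*} [NormedAddCommGroup E] [NormedSpace ℝ E] {k : ℕ}

/-- `ψ : V → M` is a smooth local parametrization of the `k`-dimensional submanifold `M`: an
immersion of an open set `V ⊆ ℝᵏ` that is a homeomorphism onto a relatively open subset of `M`. -/
structure IsLocalParam (M : Set E) (V : Set (EuclideanSpace ℝ (Fin k)))
    (ψ : EuclideanSpace ℝ (Fin k) → E) : Prop where
  isOpen : IsOpen V
  smooth : ContDiffOn ℝ ∞ ψ V
  immersion : ∀ u ∈ V, Function.Injective (fderiv ℝ ψ u)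
  embedding : IsEmbedding (V.domRestrict ψ)
  relOpen : ∃ W : Set E, IsOpen W ∧ ψ '' V = M ∩ W

/-- `M` is an embedded smooth `k`-dimensional submanifold (without boundary). -/
def IsSubmanifold (k : ℕ) (M : Set E) : Prop :=
  ∀ p ∈ M, ∃ (V : Set (EuclideanSpace ℝ (Fin k))) (ψ : EuclideanSpace ℝ (Fin k) → E),
    IsLocalParam M V ψ ∧ p ∈ ψ '' V

/-- The tangent space `T_p M`: velocities at `p` of curves in `M`. -/
def tangentVectors (M : Set E) (p : E) : Set E :=
  {v | ∃ γ : ℝ → E, γ 0 = p ∧ (∀ᶠ s in 𝓝 (0 : ℝ), γ s ∈ M) ∧ HasDerivAt γ v 0}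

/-- The frame `(∂ψ/∂u₁, …, ∂ψ/∂u_k)` at `ψ(u)`. -/
def coordFrame (ψ : EuclideanSpace ℝ (Fin k) → E) (u : EuclideanSpace ℝ (Fin k)) : Fin k → E :=
  fun i => fderiv ℝ ψ u (EuclideanSpace.single i 1)

/-- `I = ∫_M η`, for a submanifold `M` with orientation `o` (`o p v` says that the frame `v` of
`T_p M` is positive): `I = ∑_i ∫_{V_i} ψ_i^*(ρ_i η)` for finitely many positive local
parametrizations `ψ_i : V_i → M` and smooth functions `ρ_i` such that `ρ_i η` has compact support
in `ψ_i(V_i)` along `M` and `∑ ρ_i = 1` on `M ∩ supp η`. -/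
def HasFormIntegral (M : Set E) (o : E → (Fin k → E) → Prop) (η : E → E [⋀^Fin k]→L[ℝ] ℝ)
    (I : ℝ) : Prop :=
  ∃ (N : ℕ) (V : Fin N → Set (EuclideanSpace ℝ (Fin k)))
    (ψ : Fin N → EuclideanSpace ℝ (Fin k) → E) (ρ : Fin N → E → ℝ),
    (∀ i, IsLocalParam M (V i) (ψ i)) ∧
    (∀ i, ∀ u ∈ V i, o (ψ i u) (coordFrame (ψ i) u)) ∧
    (∀ i, ContDiff ℝ ∞ (ρ i)) ∧
    (∀ i, IsCompact (M ∩ tsupport (fun p => ρ i p • η p)) ∧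
      M ∩ tsupport (fun p => ρ i p • η p) ⊆ ψ i '' V i) ∧
    (∀ p ∈ M ∩ tsupport η, ∑ i, ρ i p = 1) ∧
    I = ∑ i, ∫ u in V i, ρ i (ψ i u) * η (ψ i u) (coordFrame (ψ i) u)

open Classical in
/-- The integral `∫_M η` over an oriented submanifold. -/
def formIntegral (M : Set E) (o : E → (Fin k → E) → Prop) (η : E → E [⋀^Fin k]→L[ℝ] ℝ) : ℝ :=
  if h : ∃ I, HasFormIntegral M o η I then h.choose else 0

end Submanifold

/-- A `k`-dimensional submanifold `M` of `ℍⁿ` is co-Legendrian if for every `p ∈ M` the subspace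
`T_p M ∩ ker θ_p` of the symplectic space `(ker θ_p, dθ_p)` is coisotropic, i.e. contains its
`dθ`-orthogonal complement in `ker θ_p`. -/
def IsCoLegendrian {n : ℕ} (k : ℕ) (M : Set (Heis n)) : Prop :=
  IsSubmanifold k M ∧ ∀ p ∈ M, ∀ w : Heis n, contactCovector n p w = 0 →
    (∀ v ∈ tangentVectors M p, contactCovector n p v = 0 → dContactForm n p ![w, v] = 0) →
    w ∈ tangentVectors M p

/-! ### Averaged integration over level sets -/

/-- The level set `f⁻¹(y)` of `f : U → ℝʰ`. -/
def levelSet {n h : ℕ} (U : TopologicalSpace.Opens (Heis n))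
    (f : Heis n → EuclideanSpace ℝ (Fin h)) (y : EuclideanSpace ℝ (Fin h)) : Set (Heis n) :=
  {p | p ∈ U ∧ f p = y}

/-- The orientation of the fibres of `f`: a frame `v` of `ker df_p` is positive if `(u, v)` is a
positive frame of `ℝ²ⁿ⁺¹` whenever `df_p` maps the `h`-tuple `u` to the standard basis of `ℝʰ`. -/
def levelSetOrientation {n h k : ℕ} (hk : h + k = 2 * n + 1)
    (f : Heis n → EuclideanSpace ℝ (Fin h)) (p : Heis n) (v : Fin k → Heis n) : Prop :=
  ∀ u : Fin h → Heis n, (∀ i, fderiv ℝ f p (u i) = EuclideanSpace.single i 1) →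
    0 < Matrix.det (Matrix.of fun i j : Fin (2 * n + 1) =>
      (Fin.append u v (Fin.cast hk.symm i) : Heis n) j)

/-- `T` is the averaged current of integration `T_{f,Φ}`,
`⟨T, η⟩ = ∫_{ℝʰ} (∫_{f⁻¹(y)} η) Φ(y) dy`, all integrals being well defined. -/
def IsAveragedLevelSetCurrent {n h k : ℕ} (hk : h + k = 2 * n + 1)
    (U : TopologicalSpace.Opens (Heis n)) (f : Heis n → EuclideanSpace ℝ (Fin h))
    (Φ : EuclideanSpace ℝ (Fin h) → ℝ) (T : Current U k) : Prop :=
  ∀ η : TestForm U k,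
    (∀ y, ∃! I : ℝ, HasFormIntegral (levelSet U f y) (levelSetOrientation hk f) η I) ∧
    Integrable (fun y => formIntegral (levelSet U f y) (levelSetOrientation hk f) η * Φ y) ∧
    T η = ∫ y, formIntegral (levelSet U f y) (levelSetOrientation hk f) η * Φ y

end Heisenberg

end

/-! Around each point of `U` there is a positively oriented chart in which `f` is a linear
projection. The change of variables formula and Fubini then turn the iterated integral into a single
one: `⟨T, η⟩ = ∫ Φ(f p) (f^*(dy₁ ∧ ⋯ ∧ dy_h) ∧ η)_p` (`IsFibreChart.integral_fibreDensity`, glued by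
a partition of unity in `isAveragedLevelSetCurrent_averagedCurrent`). The density `fibreDensity` is
continuous on `U`, so `T` is a current. Independence of the inner integrals from the
parametrizations is `HasFormIntegral.unique`.

The level sets are relatively closed in `U` and have no boundary there, so Stokes' theorem on each
fibre gives `∂T = 0` (`averagedCurrent_d`). Only the first of the two oblique conditions remains.
Testing against forms concentrated near a point shows that `T ⌞ χ = 0` exactly when `χ` vanishes on
`ker df_p` at every `p` with `Φ(f p) ≠ 0` (`restrictEqZero_averagedCurrent_iff`).

The rest is linear algebra with `χ = θ ∧ (dθ)^{k-n}`. The `k`-dimensional space `ker df_p` is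
transverse to `ker θ_p`; let `L` be their intersection, of dimension `k - 1`. Then `χ` vanishes on
`ker df_p` iff `(dθ)^{k-n}` vanishes on `L`, i.e. iff `dθ` has rank at most `2(k-n-1)` on `L`, i.e.
iff the radical `L ∩ L^⊥` has dimension at least `2n + 1 - k`. As `2n + 1 - k` is the dimension of
`L^⊥`, this says `L^⊥ ⊆ L` (`contactPow_eq_zero_iff_coisotropic`). -/

noncomputable section

namespace Heisenberg

/-! ### Evaluating wedge products: block frames and the interior product. -/

section WedgeAlgebra

variable {E : Type*} [NormedAddCommGroup E] [NormedSpace ℝ E]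

open Equiv Equiv.Perm in
/-- A sum over permutations of a disjoint union, whose terms vanish off the permutations that
preserve the two summands and are constant on these. -/
theorem sum_perm_sum_eq_of_block {a b : ℕ} (g : Perm (Fin a ⊕ Fin b) → ℝ) (r : ℝ)
    (hg : ∀ σ τ, g (Perm.sumCongr σ τ) = r)
    (h0 : ∀ σ : Perm (Fin a ⊕ Fin b), (∃ i j, σ (Sum.inl i) = Sum.inr j) → g σ = 0) :
    ∑ σ, g σ = (a ! : ℝ) * (b ! : ℝ) * r := by
  classical
  rw [← Finset.sum_subset
    (Finset.subset_univ ((sumCongrHom (Fin a) (Fin b)).range : Set (Perm _)).toFinset) (f := g)]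
  · rw [Finset.sum_congr rfl (g := fun _ => r)]
    · rw [Finset.sum_const, Set.toFinset_card, nsmul_eq_mul]
      congr 1
      have := sumCongrHom.card_range (α := Fin a) (β := Fin b)
      rw [Fintype.card_prod, Fintype.card_perm, Fintype.card_perm, Fintype.card_fin,
        Fintype.card_fin] at this
      rw [← Nat.cast_mul, ← this]
      congr!
    · intro σ hσ
      rw [Set.mem_toFinset] at hσ
      obtain ⟨x, rfl⟩ := hσ
      exact hg _ _
  · rintro σ - hσ
    apply h0
    by_contra hc
    push Not at hc
    apply hσ
    rw [Set.mem_toFinset]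
    apply mem_sumCongrHom_range_of_perm_mapsTo_inl
    rintro _ ⟨i, rfl⟩
    rcases hx : σ (Sum.inl i) with j | j
    · exact ⟨j, rfl⟩
    · exact absurd hx (hc i j)

open Equiv Equiv.Perm in
-- Only the permutations preserving both blocks survive. There are `a! b!` of them and all
-- contribute equally, since the signs produced by `α` and `β` cancel the sign of the permutation;
-- this cancels the normalisation of `wedge`.
theorem wedge_eq_mul_of_block {a b c : ℕ} (h : a + b = c) (α : E [⋀^Fin a]→L[ℝ] ℝ)
    (β : E [⋀^Fin b]→L[ℝ] ℝ) (w : Fin c → E)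
    (H : ∀ σ : Perm (Fin c), (∃ i j, σ (Fin.cast h (Fin.castAdd b i)) =
      Fin.cast h (Fin.natAdd a j)) →
      α (fun i => w (σ (Fin.cast h (Fin.castAdd b i)))) *
        β (fun i => w (σ (Fin.cast h (Fin.natAdd a i)))) = 0) :
    wedge h α β w = α (fun i => w (Fin.cast h (Fin.castAdd b i))) *
        β (fun i => w (Fin.cast h (Fin.natAdd a i))) := by
  subst h
  rw [wedge_apply]
  simp only [Fin.cast_eq_self] at H ⊢
  rw [← Equiv.sum_comp (permCongr finSumFinEquiv), sum_perm_sum_eq_of_block (a := a) (b := b)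
    (r := α (fun i => w (Fin.castAdd b i)) * β (fun i => w (Fin.natAdd a i)))]
  · field_simp
  · intro σ τ
    have h1 := α.toAlternatingMap.map_perm (fun i => w (Fin.castAdd b i)) σ
    have h2 := β.toAlternatingMap.map_perm (fun i => w (Fin.natAdd a i)) τ
    simp only [ContinuousAlternatingMap.coe_toAlternatingMap, Function.comp_def, Units.smul_def,
      zsmul_eq_mul] at h1 h2
    simp only [Equiv.permCongr_apply, finSumFinEquiv_symm_apply_castAdd,
      finSumFinEquiv_symm_apply_natAdd, Equiv.Perm.sumCongr_apply, Sum.map_inl, Sum.map_inr,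
      finSumFinEquiv_apply_left, finSumFinEquiv_apply_right, Equiv.Perm.sign_permCongr,
      Equiv.Perm.sign_sumCongr, h1, h2, Units.val_mul, Int.cast_mul]
    have e1 : ((sign σ : ℤ) : ℝ) * ((sign σ : ℤ) : ℝ) = 1 := by
      rw [← Int.cast_mul, ← Units.val_mul, Int.units_mul_self]; simp
    have e2 : ((sign τ : ℤ) : ℝ) * ((sign τ : ℤ) : ℝ) = 1 := by
      rw [← Int.cast_mul, ← Units.val_mul, Int.units_mul_self]; simp
    linear_combination (((sign τ : ℤ) : ℝ) * ((sign τ : ℤ) : ℝ) *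
      (α (fun i => w (Fin.castAdd b i)) * β (fun i => w (Fin.natAdd a i)))) * e1 +
      (α (fun i => w (Fin.castAdd b i)) * β (fun i => w (Fin.natAdd a i))) * e2
  · rintro σ ⟨i, j, hij⟩
    rw [H _ ⟨i, j, ?_⟩, mul_zero]
    simp [Equiv.permCongr_apply, hij]

/-- If `α` vanishes as soon as one argument is among the last `b` vectors of `w`, then
`(α ∧ β)(w)` is the product of the values on the two blocks. -/
theorem wedge_eq_mul_of_left {a b c : ℕ} (h : a + b = c) (α : E [⋀^Fin a]→L[ℝ] ℝ)
    (β : E [⋀^Fin b]→L[ℝ] ℝ) (w : Fin c → E)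
    (H : ∀ (t : Fin a → E) (i : Fin a) (j : Fin b), t i = w (Fin.cast h (Fin.natAdd a j)) →
      (∀ i, t i ∈ range w) → α t = 0) :
    wedge h α β w = α (fun i => w (Fin.cast h (Fin.castAdd b i))) *
        β (fun i => w (Fin.cast h (Fin.natAdd a i))) := by
  apply wedge_eq_mul_of_block
  rintro σ ⟨i, j, hij⟩
  rw [H _ i j (by simp only [hij]) (fun i => ⟨_, rfl⟩), zero_mul]

/-- If `β` vanishes as soon as one argument is among the first `a` vectors of `w`, then
`(α ∧ β)(w)` is the product of the values on the two blocks. -/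
theorem wedge_eq_mul_of_right {a b c : ℕ} (h : a + b = c) (α : E [⋀^Fin a]→L[ℝ] ℝ)
    (β : E [⋀^Fin b]→L[ℝ] ℝ) (w : Fin c → E)
    (H : ∀ (t : Fin b → E) (i : Fin b) (j : Fin a), t i = w (Fin.cast h (Fin.castAdd b j)) →
      (∀ i, t i ∈ range w) → β t = 0) :
    wedge h α β w = α (fun i => w (Fin.cast h (Fin.castAdd b i))) *
        β (fun i => w (Fin.cast h (Fin.natAdd a i))) := by
  apply wedge_eq_mul_of_block
  rintro σ ⟨i, j, hij⟩
  -- A permutation that moves an index of the first block into the last must move one back: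
  -- otherwise it would permute the last block, which is finite, and `j` would be hit twice.
  suffices hs : ∃ i' j', σ (Fin.cast h (Fin.natAdd a i')) = Fin.cast h (Fin.castAdd b j') by
    obtain ⟨i', j', hs⟩ := hs
    rw [H _ i' j' (by simp only [hs]) (fun i => ⟨_, rfl⟩), mul_zero]
  by_contra hc
  push Not at hc
  subst h
  simp only [Fin.cast_eq_self] at *
  have h1 : ∀ i', ∃ j', σ (Fin.natAdd a i') = Fin.natAdd a j' := fun i' => by
    generalize hy : σ (Fin.natAdd a i') = y
    induction y using Fin.addCases with
    | left x => exact absurd hy (hc i' x)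
    | right x => exact ⟨x, rfl⟩
  choose g hg using h1
  have hinj : Function.Injective g := fun x y hxy => by
    have : σ (Fin.natAdd a x) = σ (Fin.natAdd a y) := by rw [hg, hg, hxy]
    simpa using this
  obtain ⟨x, hx⟩ := (Finite.injective_iff_surjective.1 hinj) j
  have : σ (Fin.natAdd a x) = σ (Fin.castAdd b i) := by rw [hg, hx, hij]
  have := σ.injective this
  simp [Fin.ext_iff] at this
  omega

theorem wedge_eq_zero_of_terms {a b c : ℕ} (h : a + b = c) (α : E [⋀^Fin a]→L[ℝ] ℝ)
    (β : E [⋀^Fin b]→L[ℝ] ℝ) (w : Fin c → E)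
    (H : ∀ σ : Equiv.Perm (Fin c), α (fun i => w (σ (Fin.cast h (Fin.castAdd b i)))) = 0 ∨
        β (fun i => w (σ (Fin.cast h (Fin.natAdd a i)))) = 0) :
    wedge h α β w = 0 := by
  rw [wedge_apply, Finset.sum_eq_zero, mul_zero]
  intro σ _
  rcases H σ with h | h <;> simp [h]

theorem fin_zero_ne_two (b : ℕ) : (0 : Fin (b + 3)) ≠ 2 := (Fin.succ_ne_zero (1 : Fin (b + 2))).symm

theorem fin_zero_ne_one (b : ℕ) : (0 : Fin (b + 3)) ≠ 1 := (Fin.succ_ne_zero (0 : Fin (b + 2))).symm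

theorem fin_one_ne_succ_succ (b : ℕ) (i : Fin (b + 1)) : (1 : Fin (b + 3)) ≠ i.succ.succ := by
  intro hc
  have : (0 : Fin (b + 2)).succ = i.succ.succ := hc
  exact Fin.succ_ne_zero i (Fin.succ_injective _ this).symm

theorem fin_two_eq_succ_succ (b : ℕ) : (2 : Fin (b + 3)) = (0 : Fin (b + 1)).succ.succ := rfl

open Equiv Equiv.Perm in
-- Permutations are grouped by the position `p` at which they take the value `0`. By symmetry of `g`
-- the positions `0, 1` contribute equally, and so do the `b + 1` positions from `2` on. This is the
-- counting behind the Leibniz rule for the interior product with a 2-form factor.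
theorem sum_perm_fin_eq {b : ℕ} (g : Perm (Fin (b + 3)) → ℝ)
    (h1 : ∀ τ, g (τ * swap 0 1) = g τ)
    (h2 : ∀ (τ) (i : Fin (b + 1)), g (τ * swap 2 i.succ.succ) = g τ) :
    ∑ σ, g σ = 2 * ∑ e, g (decomposeFin.symm (0, e)) +
      (b + 1) * ∑ e, g (decomposeFin.symm (0, e) * swap 0 2) := by
  have hE : ∀ (p) (e : Perm (Fin (b + 2))),
      (decomposeFin.symm (p, e)) = swap 0 p * decomposeFin.symm (0, e) := by
    intro p e
    ext i
    refine Fin.cases ?_ (fun i => ?_) i <;> simp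
  have hEmul : ∀ e e' : Perm (Fin (b + 2)), (decomposeFin.symm ((0 : Fin (b + 3)), e * e')) =
      decomposeFin.symm (0, e) * decomposeFin.symm (0, e') := by
    intro e e'
    ext i
    refine Fin.cases ?_ (fun i => ?_) i <;> simp
  have hEinv : ∀ e : Perm (Fin (b + 2)), (decomposeFin.symm ((0 : Fin (b + 3)), e))⁻¹ =
      decomposeFin.symm (0, e⁻¹) := by
    intro e
    rw [inv_eq_iff_mul_eq_one, ← hEmul, mul_inv_cancel, decomposeFin_symm_of_one, swap_self]
    rfl
  have hEswap : ∀ i : Fin (b + 1), decomposeFin.symm ((0 : Fin (b + 3)), swap 1 i.succ) =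
      swap 2 i.succ.succ := by
    intro i
    ext j
    refine Fin.cases ?_ (fun j => ?_) j
    · rw [decomposeFin_symm_apply_zero,
        swap_apply_of_ne_of_ne (fin_zero_ne_two b) (Fin.succ_ne_zero _).symm]
    · rw [decomposeFin_symm_apply_succ, swap_self, refl_apply]
      have : (2 : Fin (b + 3)) = Fin.succ 1 := rfl
      rw [this, (Fin.succ_injective _).swap_apply]
  have key : ∀ i : Fin (b + 1), ∑ e, g (decomposeFin.symm (0, e) * swap 0 i.succ.succ) =
      ∑ e, g (decomposeFin.symm (0, e) * swap 0 2) := by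
    intro i
    rw [← Equiv.sum_comp (Equiv.mulRight (swap 1 i.succ))]
    refine Finset.sum_congr rfl fun e _ => ?_
    rw [Equiv.coe_mulRight, hEmul, hEswap, mul_assoc]
    have : swap (2 : Fin (b + 3)) i.succ.succ * swap 0 i.succ.succ =
        swap 0 2 * swap 2 i.succ.succ := by
      rw [Equiv.mul_swap_eq_swap_mul, swap_apply_right,
        swap_apply_of_ne_of_ne (fin_zero_ne_two b) (Fin.succ_ne_zero _).symm]
    rw [this, ← mul_assoc, h2]
  -- `decomposeFin` sorts a permutation by its value at `0`; passing to inverses sorts it by the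
  -- position of the value `0`.
  rw [← Equiv.sum_comp (Equiv.inv (Perm (Fin (b + 3)))), ← Equiv.sum_comp decomposeFin.symm,
    Fintype.sum_prod_type]
  have hrow : ∀ p : Fin (b + 3), ∑ e, g (Equiv.inv _ (decomposeFin.symm (p, e))) =
      ∑ e, g (decomposeFin.symm (0, e) * swap 0 p) := by
    intro p
    rw [← Equiv.sum_comp (Equiv.inv (Perm (Fin (b + 2))))]
    refine Finset.sum_congr rfl fun e _ => ?_
    simp only [Equiv.inv_apply]
    rw [hE, mul_inv_rev, hEinv, inv_inv, swap_inv]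
  simp only [hrow]
  rw [Fin.sum_univ_succ, Fin.sum_univ_succ]
  simp only [key, Finset.sum_const, Finset.card_univ, Fintype.card_fin, nsmul_eq_mul]
  simp only [Fin.succ_zero_eq_one, h1, swap_self]
  have : (Equiv.refl (Fin (b + 3)) : Perm _) = 1 := rfl
  rw [this]
  simp only [mul_one]
  push_cast
  ring

open Equiv Equiv.Perm in
/-- The interior product is a derivation on the product of a 2-form with another form. -/
theorem wedge_two_cons {b : ℕ} (h : 2 + (b + 1) = b + 3) (h₁ : 1 + (b + 1) = b + 2)
    (h₂ : 2 + b = b + 2) (α : E [⋀^Fin 2]→L[ℝ] ℝ) (β : E [⋀^Fin (b + 1)]→L[ℝ] ℝ) (x : E)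
    (u : Fin (b + 2) → E) :
    wedge h α β (Matrix.vecCons x u) = wedge h₁ (α.curryLeft x) β u +
      wedge h₂ α (β.curryLeft x) u := by
  have c0 : Fin.cast h (Fin.castAdd (b + 1) 0) = 0 := by simp [Fin.ext_iff]
  have c1 : Fin.cast h (Fin.castAdd (b + 1) 1) = 1 := by simp [Fin.ext_iff]
  have c2 : ∀ i, Fin.cast h (Fin.natAdd 2 i) = i.succ.succ := fun i => by
    ext; simp only [Fin.val_cast, Fin.val_natAdd, Fin.val_succ]; omega
  have c0' : Fin.cast h₂ (Fin.castAdd b 0) = 0 := by simp [Fin.ext_iff]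
  have c1' : Fin.cast h₂ (Fin.castAdd b 1) = 1 := by simp [Fin.ext_iff]
  have c2' : ∀ i, Fin.cast h₂ (Fin.natAdd 2 i) = i.succ.succ := fun i => by
    ext; simp only [Fin.val_cast, Fin.val_natAdd, Fin.val_succ]; omega
  have c0'' : ∀ i, Fin.cast h₁ (Fin.castAdd (b + 1) i) = 0 := fun i => by
    fin_cases i; simp [Fin.ext_iff]
  have c2'' : ∀ i, Fin.cast h₁ (Fin.natAdd 1 i) = i.succ := fun i => by
    ext; simp only [Fin.val_cast, Fin.val_natAdd, Fin.val_succ]; omega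
  have ha : ∀ t : Fin 2 → E, α t = α ![t 0, t 1] := fun t => by
    congr 1; ext i; fin_cases i <;> rfl
  have hswap : ∀ p q : E, α ![p, q] = - α ![q, p] := fun p q => by
    have := α.toAlternatingMap.map_swap ![q, p] (i := 0) (j := 1) (by simp)
    rw [ContinuousAlternatingMap.coe_toAlternatingMap, ha] at this
    simpa using this
  have haσ : ∀ σ : Perm (Fin (b + 3)),
      α (fun i => Matrix.vecCons x u (σ (Fin.cast h (Fin.castAdd (b + 1) i)))) =
        α ![Matrix.vecCons x u (σ 0), Matrix.vecCons x u (σ 1)] := fun σ => by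
    rw [ha, c0, c1]
  have hae : ∀ e : Perm (Fin (b + 2)), α (fun i => u (e (Fin.cast h₂ (Fin.castAdd b i)))) =
        α ![u (e 0), u (e 1)] := fun e => by
    rw [ha, c0', c1']
  have hae' : ∀ e : Perm (Fin (b + 2)),
      α (Matrix.vecCons x fun i => u (e (Fin.cast h₁ (Fin.castAdd (b + 1) i)))) =
        α ![x, u (e 0)] := fun e => by
    rw [ha]
    simp only [Matrix.cons_val_zero, Matrix.cons_val_one, c0'']
  rw [wedge_apply, wedge_apply, wedge_apply, sum_perm_fin_eq]
  · simp only [haσ, hae, hae', ContinuousAlternatingMap.curryLeft_apply_apply]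
    simp only [c2, c2', c2'', coe_mul, Function.comp_apply]
    have s2 : ∀ i : Fin b, swap (0 : Fin (b + 3)) 2 i.succ.succ.succ = i.succ.succ.succ := fun i => by
      rw [fin_two_eq_succ_succ, swap_apply_of_ne_of_ne (Fin.succ_ne_zero _)]
      intro hc
      exact Fin.succ_ne_zero i (Fin.succ_injective _ (Fin.succ_injective _ hc))
    have e1 : ∀ e : Perm (Fin (b + 2)), ((sign (decomposeFin.symm ((0 : Fin (b + 3)), e)) : ℤ) : ℝ) *
        (α ![Matrix.vecCons x u (decomposeFin.symm ((0 : Fin (b + 3)), e) 0),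
          Matrix.vecCons x u (decomposeFin.symm ((0 : Fin (b + 3)), e) 1)] *
          β fun i => Matrix.vecCons x u (decomposeFin.symm ((0 : Fin (b + 3)), e) i.succ.succ)) =
        ((sign e : ℤ) : ℝ) * (α ![x, u (e 0)] * β fun i => u (e i.succ)) := by
      intro e
      simp
    -- Here `x` occupies the first slot of `β`. The sign of `swap 0 2` is absorbed by exchanging the
    -- two arguments of `α`.
    have e2 : ∀ e : Perm (Fin (b + 2)),
        ((sign (decomposeFin.symm ((0 : Fin (b + 3)), e) * swap 0 2) : ℤ) : ℝ) *
        (α ![Matrix.vecCons x u (decomposeFin.symm ((0 : Fin (b + 3)), e) (swap 0 2 0)),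
          Matrix.vecCons x u (decomposeFin.symm ((0 : Fin (b + 3)), e) (swap 0 2 1))] *
          β fun i => Matrix.vecCons x u
            (decomposeFin.symm ((0 : Fin (b + 3)), e) (swap 0 2 i.succ.succ))) =
        ((sign e : ℤ) : ℝ) * (α ![u (e 0), u (e 1)] *
          β (Matrix.vecCons x fun i => u (e i.succ.succ))) := by
      intro e
      have t1 : swap (0 : Fin (b + 3)) 2 1 = 1 := swap_apply_of_ne_of_ne
        (fin_zero_ne_one b).symm (fin_one_ne_succ_succ b 0)
      have t2 : decomposeFin.symm ((0 : Fin (b + 3)), e) 2 = (e 1).succ := by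
        have : (2 : Fin (b + 3)) = Fin.succ 1 := rfl
        rw [this, decomposeFin_symm_apply_succ, swap_self, refl_apply]
      have t3 : (fun i : Fin (b + 1) => Matrix.vecCons x u
            (decomposeFin.symm ((0 : Fin (b + 3)), e) (swap 0 2 i.succ.succ))) =
          Matrix.vecCons x fun i => u (e i.succ.succ) := by
        ext1 i
        refine Fin.cases ?_ (fun i => ?_) i
        · have : Fin.succ (Fin.succ (0 : Fin (b + 1))) = 2 := rfl
          rw [this, swap_apply_right, decomposeFin_symm_apply_zero]
          rfl
        · rw [s2, decomposeFin_symm_apply_succ, swap_self, refl_apply]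
          rfl
      have t4 : sign (swap (0 : Fin (b + 3)) 2) = -1 := sign_swap (fin_zero_ne_two b)
      rw [t1, t3, swap_apply_left, t2, Perm.sign_mul, t4, decomposeFin.symm_sign,
        decomposeFin_symm_apply_one, swap_self, refl_apply]
      simp only [Matrix.cons_val_succ]
      rw [hswap (u (e 1))]
      simp
    simp only [e1, e2]
    simp only [Nat.factorial, Nat.cast_mul, Nat.cast_add, Nat.cast_one, Nat.succ_eq_add_one]
    have : ((b : ℝ) + 1) ≠ 0 := by positivity
    field_simp
    ring
  · intro τ
    have hs : sign (swap (0 : Fin (b + 3)) 1) = -1 := sign_swap (fin_zero_ne_one b)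
    have hf : ∀ i : Fin (b + 1), swap (0 : Fin (b + 3)) 1 i.succ.succ = i.succ.succ := fun i =>
      swap_apply_of_ne_of_ne (Fin.succ_ne_zero _)
        (fin_one_ne_succ_succ b i).symm
    simp only [haσ]
    simp only [c2, Perm.sign_mul, hs, coe_mul, Function.comp_apply, hf,
      swap_apply_left, swap_apply_right]
    rw [hswap]
    simp
  · intro τ i
    by_cases hi : i = 0
    · subst hi
      have : swap (2 : Fin (b + 3)) (Fin.succ (Fin.succ 0)) = 1 := swap_self _
      rw [this, mul_one]
    have hs : sign (swap (2 : Fin (b + 3)) i.succ.succ) = -1 := by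
      rw [fin_two_eq_succ_succ]
      refine sign_swap fun hc => hi ?_
      exact ((Fin.succ_injective _ (Fin.succ_injective _ hc))).symm
    have hf : ∀ j : Fin (b + 1), swap (2 : Fin (b + 3)) i.succ.succ j.succ.succ =
        (swap 0 i j).succ.succ := fun j => by
      have : (2 : Fin (b + 3)) = Fin.succ (Fin.succ 0) := rfl
      rw [this, (Fin.succ_injective _).swap_apply, (Fin.succ_injective _).swap_apply]
    have h0 : swap (2 : Fin (b + 3)) i.succ.succ 0 = 0 :=
      swap_apply_of_ne_of_ne (fin_zero_ne_two b) (Fin.succ_ne_zero _).symm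
    have h1 : swap (2 : Fin (b + 3)) i.succ.succ 1 = 1 :=
      swap_apply_of_ne_of_ne (fin_one_ne_succ_succ b 0) (fin_one_ne_succ_succ b i)
    simp only [haσ]
    simp only [c2, Perm.sign_mul, hs, coe_mul, Function.comp_apply, hf, h0, h1]
    have := β.toAlternatingMap.map_swap (fun j => Matrix.vecCons x u (τ j.succ.succ))
      (Ne.symm hi)
    simp only [ContinuousAlternatingMap.coe_toAlternatingMap, Function.comp_def] at this
    rw [this]
    simp

end WedgeAlgebra

/-! ### Symplectic linear algebra on the contact hyperplane. -/

section ContactAlgebra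

variable {n : ℕ}

theorem update_pair_zero {V : Type*} (w v x : V) : Function.update ![w, v] 0 x = ![x, v] := by
  ext1 i; fin_cases i <;> simp

theorem update_pair_one {V : Type*} (w v x : V) : Function.update ![w, v] 1 x = ![w, x] := by
  ext1 i; fin_cases i <;> simp

/-- The bilinear form `(w, v) ↦ dθ(w, v)`. -/
def contactBilin (n : ℕ) (p : Heis n) : LinearMap.BilinForm ℝ (Heis n) :=
  LinearMap.mk₂ ℝ (fun w v => dContactForm n p ![w, v])
    (fun w w' v => by
      have := (dContactForm n p).map_update_add ![w, v] 0 w w'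
      rwa [update_pair_zero, update_pair_zero, update_pair_zero] at this)
    (fun c w v => by
      have := (dContactForm n p).map_update_smul ![w, v] 0 c w
      rwa [update_pair_zero, update_pair_zero] at this)
    (fun w v v' => by
      have := (dContactForm n p).map_update_add ![w, v] 1 v v'
      rwa [update_pair_one, update_pair_one, update_pair_one] at this)
    (fun c w v => by
      have := (dContactForm n p).map_update_smul ![w, v] 1 c v
      rwa [update_pair_one, update_pair_one] at this)

theorem contactBilin_apply (p w v : Heis n) :
    contactBilin n p w v = dContactForm n p ![w, v] := rfl

theorem dContactForm_apply_eq (p : Heis n) (t : Fin 2 → Heis n) :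
    dContactForm n p t = contactBilin n p (t 0) (t 1) := by
  rw [contactBilin_apply]
  congr 1
  ext1 i
  fin_cases i <;> rfl

theorem contactBilin_swap (p w v : Heis n) : contactBilin n p w v = -contactBilin n p v w := by
  have := (dContactForm n p).toAlternatingMap.map_swap ![v, w] (i := 0) (j := 1) (by simp)
  rw [ContinuousAlternatingMap.coe_toAlternatingMap, dContactForm_apply_eq] at this
  simpa [contactBilin_apply] using this

/-- The covector `θ_p` is affine in `p` with linear part `-Λ`; antisymmetrizing `-Λ` doubles each
term and removes the factor `1/2`. In particular `dθ` has constant coefficients and `∂_t` lies in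
its radical. -/
theorem contactBilin_eq (p w v : Heis n) : contactBilin n p w v =
    -∑ j : Fin n, (w (ix j) * v (iy j) - w (iy j) * v (ix j)) := by
  let Λ : Heis n →L[ℝ] Heis n →L[ℝ] ℝ := (1 / 2 : ℝ) • ∑ j : Fin n,
    ((EuclideanSpace.proj (ix j) : Heis n →L[ℝ] ℝ).smulRight
        (EuclideanSpace.proj (iy j) : Heis n →L[ℝ] ℝ) -
      (EuclideanSpace.proj (iy j) : Heis n →L[ℝ] ℝ).smulRight
        (EuclideanSpace.proj (ix j) : Heis n →L[ℝ] ℝ))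
  have hΛ : ∀ q, contactCovector n q = EuclideanSpace.proj (Fin.last (2 * n)) - Λ q := by
    intro q
    ext v
    simp [contactCovector, Λ]
  have hd : HasFDerivAt (contactForm n)
      ((ContinuousAlternatingMap.ofSubsingletonLIE (𝕜 := ℝ) (E := Heis n) (F := ℝ)
        (0 : Fin 1)).toContinuousLinearEquiv.toContinuousLinearMap.comp (-Λ)) p := by
    have h1 : HasFDerivAt (contactCovector n) (-Λ) p := by
      rw [funext hΛ]
      simpa using Λ.hasFDerivAt.const_sub _
    exact ((ContinuousAlternatingMap.ofSubsingletonLIE (𝕜 := ℝ) (E := Heis n) (F := ℝ)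
        (0 : Fin 1)).toContinuousLinearEquiv.toContinuousLinearMap.hasFDerivAt).comp p h1
  rw [contactBilin_apply, dContactForm, extDeriv, hd.fderiv,
    ContinuousAlternatingMap.alternatizeUncurryFin_apply]
  simp [Fin.sum_univ_two, Λ, Fin.removeNth, ContinuousAlternatingMap.ofSubsingletonLIE,
    Finset.sum_sub_distrib]
  simp only [mul_comm (w _)]
  ring

/-- Each term of the expanded power feeds `w i` to some factor `dθ`, together with another `w j`. -/
theorem dContactPow_eq_zero_of_mem_radical (p : Heis n) : ∀ (m : ℕ) (w : Fin (2 * m) → Heis n)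
    (i : Fin (2 * m)), (∀ j, contactBilin n p (w i) (w j) = 0) → dContactPow n m p w = 0
  | 0, _, i, _ => i.elim0
  | m + 1, w, i, hi => by
    rw [dContactPow]
    apply wedge_eq_zero_of_terms
    intro σ
    obtain ⟨i', rfl⟩ : ∃ i', i = σ i' := ⟨σ.symm i, by simp⟩
    have hc : 2 + 2 * m = 2 * (m + 1) := by ring
    obtain ⟨i'', rfl⟩ : ∃ i'', i' = Fin.cast hc i'' := ⟨Fin.cast hc.symm i', by simp⟩
    induction i'' using Fin.addCases with
    | left x =>
      left
      rw [dContactForm_apply_eq]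
      fin_cases x
      · exact hi _
      · rw [contactBilin_swap, neg_eq_zero]
        exact hi _
    | right x =>
      right
      exact dContactPow_eq_zero_of_mem_radical p m _ x fun j => hi _

/-- This is `ι_a (dθ)^{m+1} = (m+1) (ι_a dθ) ∧ (dθ)^m` evaluated at `(b, l)`, where `ι_a dθ` only
sees `b`. In the induction the Leibniz rule `wedge_two_cons` yields one copy of `dθ(a, b)
(dθ)^{m+1}(l)` from the first factor and `m + 1` copies from the remaining power. -/
theorem dContactPow_cons_cons (p : Heis n) : ∀ (m : ℕ) (a b : Heis n) (l : Fin (2 * m) → Heis n),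
    (∀ i, contactBilin n p a (l i) = 0) →
    dContactPow n (m + 1) p (Matrix.vecCons a (Matrix.vecCons b l)) =
      (m + 1) * contactBilin n p a b * dContactPow n m p l
  | 0, a, b, l, hl => by
    refine (wedge_eq_mul_of_left (a := 2) (b := 0) rfl (dContactForm n p) (dContactPow n 0 p) _
      (fun t i j => j.elim0)).trans ?_
    rw [dContactForm_apply_eq]
    simp [dContactPow]
  | m + 1, a, b, l, hl => by
    have h1 : 1 + 2 * (m + 1) = 2 * (m + 1) + 1 := by ring
    have h2 : 2 + (2 * m + 1) = 2 * m + 3 := by ring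
    have h3 : 1 + (2 * m + 1) = 2 * m + 2 := by ring
    have h4 : 2 + 2 * m = 2 * m + 2 := by ring
    rw [dContactPow]
    refine (wedge_two_cons (b := 2 * m + 1) _ h1 h2 (dContactForm n p) (dContactPow n (m + 1) p) a
      (Matrix.vecCons b l)).trans ?_
    have e1 : wedge h1 ((dContactForm n p).curryLeft a) (dContactPow n (m + 1) p)
        (Matrix.vecCons b l) = contactBilin n p a b * dContactPow n (m + 1) p l := by
      rw [wedge_eq_mul_of_left]
      · rw [ContinuousAlternatingMap.curryLeft_apply_apply, dContactForm_apply_eq]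
        congr 1
        congr 1
        ext1 i
        have : Fin.cast h1 (Fin.natAdd 1 i) = i.succ := by
          ext; simp only [Fin.val_cast, Fin.val_natAdd, Fin.val_succ]; omega
        rw [this]
        rfl
      · intro t i j hij _
        have : Fin.cast h1 (Fin.natAdd 1 j) = j.succ := by
          ext; simp only [Fin.val_cast, Fin.val_natAdd, Fin.val_succ]; omega
        rw [this, Matrix.cons_val_succ] at hij
        rw [ContinuousAlternatingMap.curryLeft_apply_apply, dContactForm_apply_eq]
        have hi : i = 0 := Subsingleton.elim _ _
        subst hi
        simp only [Matrix.cons_val_zero, Matrix.cons_val_one]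
        rw [hij, hl]
    have e2 : wedge h2 (dContactForm n p) ((dContactPow n (m + 1) p).curryLeft a)
        (Matrix.vecCons b l) =
        ((m + 1) * contactBilin n p a b) * dContactPow n (m + 1) p l := by
      -- Contract with `b` as well. The term where `b` enters `dθ` vanishes, because the other
      -- factor then gets `a` and vectors of `l`, all orthogonal to `a`; the other term is the
      -- induction hypothesis.
      rw [wedge_two_cons (b := 2 * m) h2 h3 h4]
      rw [wedge_eq_zero_of_terms h3, zero_add]
      · have e3 : dContactPow n (m + 1) p l = wedge h4 (dContactForm n p) (dContactPow n m p) l :=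
          rfl
        rw [e3, wedge_apply, wedge_apply, mul_left_comm]
        congr 1
        rw [Finset.mul_sum]
        refine Finset.sum_congr rfl fun σ _ => ?_
        rw [ContinuousAlternatingMap.curryLeft_apply_apply,
          ContinuousAlternatingMap.curryLeft_apply_apply]
        rw [dContactPow_cons_cons p m a b _ (fun i => hl _)]
        ring
      · intro σ
        right
        rw [ContinuousAlternatingMap.curryLeft_apply_apply]
        apply dContactPow_eq_zero_of_mem_radical p (m + 1) _ 0
        intro j
        refine Fin.cases ?_ (fun j => ?_) j
        · have := contactBilin_swap p a a
          show contactBilin n p a a = 0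
          linarith
        · exact hl _
    rw [e1, e2]
    push_cast
    ring

/-- If `(dθ)^m` vanishes on `L`, the radical of `dθ` on `L` is cut out by fewer than `2m`
equations. -/
theorem exists_radical_equations (p : Heis n) (L : Submodule ℝ (Heis n)) (m : ℕ)
    (H : ∀ v : Fin (2 * m) → Heis n, (∀ i, v i ∈ L) → dContactPow n m p v = 0) :
    ∃ j < m, ∃ l : Fin (2 * j) → Heis n, ∀ a ∈ L, (∀ i, contactBilin n p a (l i) = 0) →
      ∀ b ∈ L, contactBilin n p a b = 0 := by
  classical
  -- Take the least power of `dθ` vanishing on `L`. It is not the zeroth, which is `1`, so it is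
  -- some `j + 1`, and `(dθ)^j` is nonzero on a tuple `l` in `L`. For `a` orthogonal to `l`, `0 =
  -- (dθ)^{j+1}(a, b, l) = (j+1) dθ(a, b) (dθ)^j(l)`.
  have hex : ∃ m, ∀ v : Fin (2 * m) → Heis n, (∀ i, v i ∈ L) → dContactPow n m p v = 0 := ⟨m, H⟩
  have hm : Nat.find hex ≤ m := Nat.find_min' hex H
  have h0 := Nat.find_spec hex
  have h1 := fun j => Nat.find_min hex (m := j)
  generalize Nat.find hex = j at hm h0 h1
  cases j with
  | zero =>
    have := h0 (fun i => i.elim0) (fun i => i.elim0)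
    simp [dContactPow] at this
  | succ j =>
    have h2 := h1 j (Nat.lt_succ_self j)
    push Not at h2
    obtain ⟨l, hl, hne⟩ := h2
    refine ⟨j, hm, l, fun a ha hal b hb => ?_⟩
    have h3 := dContactPow_cons_cons p j a b l hal
    rw [h0] at h3
    · have h4 : ((j : ℝ) + 1) ≠ 0 := by positivity
      have h5 := h3.symm
      simpa [h4, hne] using h5
    · intro i
      refine Fin.cases ha (fun i => ?_) i
      exact Fin.cases hb (fun i => hl i) i

theorem contactCovector_apply_last (p : Heis n) :
    contactCovector n p (EuclideanSpace.single (Fin.last (2 * n)) 1) = 1 := by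
  have h1 : ∀ j : Fin n, iy j ≠ Fin.last (2 * n) := fun j => by simp [iy, Fin.ext_iff]; omega
  have h2 : ∀ j : Fin n, ix j ≠ Fin.last (2 * n) := fun j => by simp [ix, Fin.ext_iff]; omega
  simp [contactCovector, h1, h2]

theorem finrank_ker_contactCovector (p : Heis n) :
    Module.finrank ℝ (LinearMap.ker (contactCovector n p : Heis n →ₗ[ℝ] ℝ)) = 2 * n := by
  have h1 := LinearMap.finrank_range_add_finrank_ker (contactCovector n p : Heis n →ₗ[ℝ] ℝ)
  have h2 : LinearMap.range (contactCovector n p : Heis n →ₗ[ℝ] ℝ) = ⊤ := by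
    apply LinearMap.range_eq_top.2
    intro c
    refine ⟨c • EuclideanSpace.single (Fin.last (2 * n)) 1, ?_⟩
    rw [map_smul]
    simp [contactCovector_apply_last]
  rw [h2, finrank_top, Module.finrank_self, finrank_euclideanSpace_fin] at h1
  omega

/-- Nondegeneracy of `dθ` on `ker θ`. The test vectors are the horizontal projections `e_i - θ(e_i)
∂_t`; since `∂_t` is in the radical of `dθ`, they detect all `x` and `y` coordinates of `w`, and
`θ(w) = 0` then kills the last one. -/
theorem eq_zero_of_contactBilin_eq_zero (p w : Heis n) (hw : contactCovector n p w = 0)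
    (H : ∀ v, contactCovector n p v = 0 → contactBilin n p w v = 0) : w = 0 := by
  have h1 : ∀ j : Fin n, iy j ≠ Fin.last (2 * n) := fun j => by simp [iy, Fin.ext_iff]; omega
  have h2 : ∀ j : Fin n, ix j ≠ Fin.last (2 * n) := fun j => by simp [ix, Fin.ext_iff]; omega
  have h3 : ∀ i j : Fin n, ix i ≠ iy j := fun i j => by simp [ix, iy, Fin.ext_iff]; omega
  have h4 : ∀ i j : Fin n, ix i = ix j ↔ i = j := fun i j => by simp [ix, Fin.ext_iff]
  have h5 : ∀ i j : Fin n, iy i = iy j ↔ i = j := fun i j => by simp [iy, Fin.ext_iff]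
  have key : ∀ i, contactBilin n p w (EuclideanSpace.single i 1) = 0 := by
    intro i
    have := H (EuclideanSpace.single i 1 - contactCovector n p (EuclideanSpace.single i 1) •
      EuclideanSpace.single (Fin.last (2 * n)) 1)
      (by rw [map_sub, map_smul, contactCovector_apply_last]; simp)
    rw [map_sub, map_smul] at this
    have h0 : contactBilin n p w (EuclideanSpace.single (Fin.last (2 * n)) 1) = 0 := by
      rw [contactBilin_eq]
      simp [h1, h2]
    rwa [h0, smul_zero, sub_zero] at this
  have hx : ∀ j, w (ix j) = 0 := fun j => by
    have := key (iy j)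
    rw [contactBilin_eq] at this
    simpa [h3, h5, Finset.sum_ite_eq] using this
  have hy : ∀ j, w (iy j) = 0 := fun j => by
    have := key (ix j)
    rw [contactBilin_eq] at this
    simpa [fun i j => (h3 i j).symm, h4, Finset.sum_ite_eq] using this
  have ht : w (Fin.last (2 * n)) = 0 := by
    simpa [contactCovector, hx, hy] using hw
  ext i
  by_cases hi : (i : ℕ) < n
  · exact hx ⟨i, hi⟩
  by_cases hi' : (i : ℕ) < 2 * n
  · have := hy ⟨i - n, by omega⟩
    have e : (iy ⟨i - n, by omega⟩ : Fin (2 * n + 1)) = i := by simp [iy, Fin.ext_iff]; omega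
    rwa [e] at this
  · have e : i = Fin.last (2 * n) := by simp [Fin.ext_iff]; omega
    rw [e]
    exact ht

/-- The `dθ`-orthogonal complement of `L` in the contact hyperplane. -/
def contactOrthogonal (p : Heis n) (L : Submodule ℝ (Heis n)) : Submodule ℝ (Heis n) where
  carrier := {w | contactCovector n p w = 0 ∧ ∀ v ∈ L, contactBilin n p w v = 0}
  add_mem' := fun {a b} ha hb => ⟨by rw [map_add, ha.1, hb.1, add_zero], fun v hv => by
    rw [map_add, LinearMap.add_apply, ha.2 v hv, hb.2 v hv, add_zero]⟩
  zero_mem' := ⟨map_zero _, fun v _ => by rw [map_zero, LinearMap.zero_apply]⟩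
  smul_mem' := fun c a ha => ⟨by rw [map_smul, ha.1, smul_zero], fun v hv => by
    rw [map_smul, LinearMap.smul_apply, ha.2 v hv, smul_zero]⟩

theorem mem_contactOrthogonal {p : Heis n} {L : Submodule ℝ (Heis n)} {w : Heis n} :
    w ∈ contactOrthogonal p L ↔
      contactCovector n p w = 0 ∧ ∀ v ∈ L, contactBilin n p w v = 0 := Iff.rfl

theorem finrank_contactOrthogonal (p : Heis n) (L : Submodule ℝ (Heis n))
    (hL : ∀ v ∈ L, contactCovector n p v = 0) :
    Module.finrank ℝ (contactOrthogonal p L) + Module.finrank ℝ L = 2 * n := by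
  set K := LinearMap.ker (contactCovector n p : Heis n →ₗ[ℝ] ℝ) with hK
  have hLK : L ≤ K := fun v hv => hL v hv
  let B : LinearMap.BilinForm ℝ K := (contactBilin n p).restrict K
  have hB : B.Nondegenerate := by
    constructor
    · intro x hx
      apply Subtype.ext
      apply eq_zero_of_contactBilin_eq_zero p x x.2
      intro v hv
      exact hx ⟨v, hv⟩
    · intro x hx
      apply Subtype.ext
      apply eq_zero_of_contactBilin_eq_zero p x x.2
      intro v hv
      rw [contactBilin_swap, neg_eq_zero]
      exact hx ⟨v, hv⟩
  have h1 := LinearMap.BilinForm.finrank_orthogonal hB (L.comap K.subtype)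
  have h2 : Module.finrank ℝ (L.comap K.subtype) = Module.finrank ℝ L :=
    (Submodule.comapSubtypeEquivOfLe hLK).finrank_eq
  have h3 : Module.finrank ℝ (B.orthogonal (L.comap K.subtype)) =
      Module.finrank ℝ (contactOrthogonal p L) := by
    have h4 : B.orthogonal (L.comap K.subtype) = (contactOrthogonal p L).comap K.subtype := by
      ext x
      rw [LinearMap.BilinForm.mem_orthogonal_iff, Submodule.mem_comap, mem_contactOrthogonal]
      constructor
      · intro hx
        refine ⟨x.2, fun v hv => ?_⟩
        rw [contactBilin_swap, neg_eq_zero]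
        exact hx ⟨v, hLK hv⟩ hv
      · intro hx v hv
        have := hx.2 v hv
        rw [contactBilin_swap, neg_eq_zero] at this
        exact this
    rw [h4]
    exact (Submodule.comapSubtypeEquivOfLe (q := K) (p := contactOrthogonal p L)
      (fun w hw => (mem_contactOrthogonal.1 hw).1)).finrank_eq
  have h5 : Module.finrank ℝ L ≤ Module.finrank ℝ K := Submodule.finrank_mono hLK
  rw [h2, h3, finrank_ker_contactCovector] at h1
  rw [finrank_ker_contactCovector] at h5
  omega

theorem finrank_le_finrank_ker_add {V : Type*} [AddCommGroup V] [Module ℝ V]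
    [FiniteDimensional ℝ V] (P : Submodule ℝ V) {r : ℕ} (g : V →ₗ[ℝ] (Fin r → ℝ)) :
    Module.finrank ℝ P ≤ Module.finrank ℝ (P ⊓ LinearMap.ker g : Submodule ℝ V) + r := by
  have h1 := LinearMap.finrank_range_add_finrank_ker (g.domRestrict P)
  have h2 : Module.finrank ℝ (LinearMap.range (g.domRestrict P)) ≤ r := by
    simpa using Submodule.finrank_le (LinearMap.range (g.domRestrict P))
  have h3 : Module.finrank ℝ (LinearMap.ker (g.domRestrict P)) =
      Module.finrank ℝ (P ⊓ LinearMap.ker g : Submodule ℝ V) := by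
    rw [LinearMap.ker_domRestrict, ← Submodule.finrank_map_subtype_eq]
    rw [Submodule.map_comap_subtype]
  omega

/-- If `(dθ)^{k-n}` vanishes on the `(k-1)`-dimensional subspace `L` of the contact hyperplane,
then `L` is coisotropic. -/
theorem contactOrthogonal_le_of_dContactPow_eq_zero {k : ℕ} (hnk : n + 1 ≤ k) (p : Heis n)
    (L : Submodule ℝ (Heis n)) (hL : ∀ v ∈ L, contactCovector n p v = 0)
    (hdim : Module.finrank ℝ L + 1 = k)
    (H : ∀ v : Fin (2 * (k - n)) → Heis n, (∀ i, v i ∈ L) → dContactPow n (k - n) p v = 0) :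
    contactOrthogonal p L ≤ L := by
  obtain ⟨j, hj, l, hl⟩ := exists_radical_equations p L (k - n) H
  let g : Heis n →ₗ[ℝ] (Fin (2 * j) → ℝ) :=
    LinearMap.pi fun i => (contactBilin n p).flip (l i)
  have h1 := finrank_le_finrank_ker_add L g
  -- The `2j ≤ 2(k-n-1)` equations leave at least `(k-1) - 2(k-n-1) = 2n+1-k` dimensions of `L`, all
  -- inside `L^⊥`, whose dimension is exactly `2n+1-k`. Hence the two spaces coincide.
  have h2 : L ⊓ LinearMap.ker g ≤ contactOrthogonal p L := by
    rintro a ⟨ha, hga⟩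
    refine ⟨hL a ha, hl a ha fun i => ?_⟩
    exact congrFun (LinearMap.mem_ker.1 hga) i
  have h3 := finrank_contactOrthogonal p L hL
  have h4 := Submodule.finrank_mono h2
  have h5 : L ⊓ LinearMap.ker g = contactOrthogonal p L :=
    Submodule.eq_of_le_of_finrank_le h2 (by omega)
  rw [← h5]
  exact inf_le_left

/-- If `K` is `k`-dimensional and transverse to the contact hyperplane, which it meets in a
coisotropic subspace, then `θ ∧ (dθ)^{k-n}` vanishes on `K`. -/
theorem contactPow_eq_zero_of_coisotropic {k : ℕ} (hnk : n + 1 ≤ k) (p : Heis n)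
    (K : Submodule ℝ (Heis n)) (hdim : Module.finrank ℝ K = k) (w : Heis n) (hw : w ∈ K)
    (hw1 : contactCovector n p w = 1)
    (H : contactOrthogonal p (K ⊓ LinearMap.ker (contactCovector n p : Heis n →ₗ[ℝ] ℝ)) ≤ K)
    (v : Fin (1 + 2 * (k - n)) → Heis n) (hv : ∀ i, v i ∈ K) :
    contactPow n (k - n) p v = 0 := by
  by_cases hli : LinearIndependent ℝ v
  swap
  · exact (contactPow n (k - n) p).toAlternatingMap.map_linearDependent v hli
  set L := K ⊓ LinearMap.ker (contactCovector n p : Heis n →ₗ[ℝ] ℝ) with hLdef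
  have hL : ∀ v ∈ L, contactCovector n p v = 0 := fun v hv => hv.2
  have hLdim : Module.finrank ℝ L + 1 = k := by
    have h1 : Module.finrank ℝ L < Module.finrank ℝ K := by
      apply Submodule.finrank_lt_finrank_of_lt
      refine lt_of_le_of_ne inf_le_left fun hc => ?_
      have : w ∈ L := by rw [hc]; exact hw
      rw [hL w this] at hw1
      exact zero_ne_one hw1
    have h2 := finrank_le_finrank_ker_add K
      (LinearMap.pi fun _ : Fin 1 => (contactCovector n p : Heis n →ₗ[ℝ] ℝ))
    have h3 : LinearMap.ker (LinearMap.pi fun _ : Fin 1 => (contactCovector n p : Heis n →ₗ[ℝ] ℝ))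
        = LinearMap.ker (contactCovector n p : Heis n →ₗ[ℝ] ℝ) := by
      rw [LinearMap.ker_pi]; simp
    rw [h3, ← hLdef] at h2
    omega
  have hP := finrank_contactOrthogonal p L hL
  have h1 := finrank_le_finrank_ker_add (contactOrthogonal p L)
    (LinearMap.pi fun _ : Fin 1 => (contactBilin n p).flip w)
  rw [LinearMap.ker_pi, iInf_const] at h1
  -- `R` lies in `ker θ` and in the radical of `dθ` on all of `K = L ⊕ ℝw`. Its dimension is at
  -- least `2n - k`, and `(2n - k) + (1 + 2(k-n)) = k + 1` exceeds `dim K`, so `R` meets the span of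
  -- `v` nontrivially.
  set R := contactOrthogonal p L ⊓ LinearMap.ker ((contactBilin n p).flip w) with hR
  have hRK : R ≤ K := inf_le_left.trans H
  have hRrad : ∀ r ∈ R, ∀ x ∈ K, contactBilin n p r x = 0 := by
    rintro r ⟨hr, hrw⟩ x hx
    have h2 : x - contactCovector n p x • w ∈ L := by
      refine ⟨K.sub_mem hx (K.smul_mem _ hw), ?_⟩
      simp [hw1]
    have h3 := hr.2 _ h2
    have h4 : contactBilin n p r w = 0 := hrw
    rwa [map_sub, map_smul, h4, smul_zero, sub_zero] at h3
  have hspan : Submodule.span ℝ (range v) ≤ K := Submodule.span_le.2 (by rintro _ ⟨i, rfl⟩; exact hv i)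
  have hsd : Module.finrank ℝ (Submodule.span ℝ (range v)) = 1 + 2 * (k - n) := by
    simpa using finrank_span_eq_card hli
  have h2 := Submodule.finrank_sup_add_finrank_inf_eq (Submodule.span ℝ (range v)) R
  have h3 := Submodule.finrank_mono (sup_le hspan hRK)
  have h4 : Submodule.span ℝ (range v) ⊓ R ≠ ⊥ := by
    intro hc
    rw [hc, finrank_bot] at h2
    omega
  obtain ⟨r, ⟨hrs, hrR⟩, hr0⟩ := Submodule.exists_mem_ne_zero_of_ne_bot h4
  obtain ⟨c, rfl⟩ := (Submodule.mem_span_range_iff_exists_fun ℝ).1 hrs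
  obtain ⟨i, hi⟩ : ∃ i, c i ≠ 0 := by
    by_contra hc
    push Not at hc
    exact hr0 (by simp [hc])
  set r := ∑ i, c i • v i with hrdef
  -- Replacing `v i` by `r` multiplies the value by `c i ≠ 0`, while any form built from `θ` and
  -- `dθ` vanishes once `r` is an argument.
  have h5 : contactPow n (k - n) p (Function.update v i r) = c i * contactPow n (k - n) p v := by
    have := (contactPow n (k - n) p).toAlternatingMap.map_update_sum
      (t := Finset.univ) (i := i) (g := fun j => c j • v j) (m := v)
    simp only [ContinuousAlternatingMap.coe_toAlternatingMap] at this
    rw [hrdef, this, Finset.sum_eq_single i]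
    · rw [ContinuousAlternatingMap.map_update_smul, Function.update_eq_self, smul_eq_mul]
    · intro j _ hj
      rw [ContinuousAlternatingMap.map_update_smul,
        (contactPow n (k - n) p).map_eq_zero_of_eq _ (i := i) (j := j) (by simp [hj]) hj.symm,
        smul_zero]
    · simp
  have h6 : contactPow n (k - n) p (Function.update v i r) = 0 := by
    rw [contactPow]
    apply wedge_eq_zero_of_terms
    intro σ
    have hmem : ∀ j, Function.update v i r j ∈ K := fun j => by
      by_cases hj : j = i
      · subst hj; simpa using hRK hrR
      · simpa [hj] using hv j
    obtain ⟨i', hi'⟩ : ∃ i', σ i' = i := ⟨σ.symm i, by simp⟩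
    induction i' using Fin.addCases with
    | left x =>
      left
      have hx : x = 0 := Subsingleton.elim _ _
      subst hx
      show contactCovector n p (Function.update v i r (σ (Fin.castAdd _ 0))) = 0
      rw [hi', Function.update_self]
      exact hrR.1.1
    | right x =>
      right
      apply dContactPow_eq_zero_of_mem_radical p _ _ x
      intro j
      simp only [Fin.cast_eq_self]
      rw [hi', Function.update_self]
      exact hRrad r hrR _ (hmem _)
  rw [h6] at h5
  simpa [hi] using h5.symm

end ContactAlgebra

/-! ### The density of a form along the kernel of a linear map. -/

section Density

/-- The determinant of `N` vectors of `ℝᴺ`, as a form of top degree. -/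
def detForm (N : ℕ) : EuclideanSpace ℝ (Fin N) [⋀^Fin N]→L[ℝ] ℝ where
  toMultilinearMap := (EuclideanSpace.basisFun (Fin N) ℝ).toBasis.det.toMultilinearMap
  map_eq_zero_of_eq' := (EuclideanSpace.basisFun (Fin N) ℝ).toBasis.det.map_eq_zero_of_eq'
  cont := by
    show Continuous fun v => (EuclideanSpace.basisFun (Fin N) ℝ).toBasis.det v
    simp only [Module.Basis.det_apply]
    refine Continuous.matrix_det (continuous_matrix fun i j => ?_)
    simp only [Module.Basis.toMatrix_apply, OrthonormalBasis.coe_toBasis_repr_apply,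
      EuclideanSpace.basisFun_repr]
    fun_prop

theorem detForm_eq_basis_det {N : ℕ} (v : Fin N → EuclideanSpace ℝ (Fin N)) :
    detForm N v = (EuclideanSpace.basisFun (Fin N) ℝ).toBasis.det v := rfl

theorem detForm_apply {N : ℕ} (v : Fin N → EuclideanSpace ℝ (Fin N)) :
    detForm N v = Matrix.det (Matrix.of fun i j => v i j) := by
  rw [detForm_eq_basis_det, Module.Basis.det_apply, ← Matrix.det_transpose]
  rfl

/-- The standard frame of `ℝᴺ`. -/
def stdFrame (N : ℕ) : Fin N → EuclideanSpace ℝ (Fin N) := fun i => EuclideanSpace.single i 1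

theorem coe_basisFun_toBasis (N : ℕ) :
    ⇑(EuclideanSpace.basisFun (Fin N) ℝ).toBasis = stdFrame N := by
  ext1 i
  simp [stdFrame]

theorem detForm_stdFrame (N : ℕ) : detForm N (stdFrame N) = 1 := by
  rw [detForm_eq_basis_det, ← coe_basisFun_toBasis, Module.Basis.det_self]

theorem alternatingMap_eq_detForm {N : ℕ} (g : EuclideanSpace ℝ (Fin N) [⋀^Fin N]→ₗ[ℝ] ℝ)
    (v : Fin N → EuclideanSpace ℝ (Fin N)) : g v = detForm N v * g (stdFrame N) := by
  rw [g.eq_smul_basis_det (EuclideanSpace.basisFun (Fin N) ℝ).toBasis, coe_basisFun_toBasis]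
  simp only [AlternatingMap.smul_apply, smul_eq_mul]
  rw [← detForm_eq_basis_det, ← detForm_eq_basis_det, detForm_stdFrame]
  ring

theorem detForm_comp_stdFrame {N : ℕ}
    (L : EuclideanSpace ℝ (Fin N) →L[ℝ] EuclideanSpace ℝ (Fin N)) :
    detForm N (fun i => L (stdFrame N i)) = L.det := by
  have := (EuclideanSpace.basisFun (Fin N) ℝ).toBasis.det_comp (L : _ →ₗ[ℝ] _) (stdFrame N)
  rw [← detForm_eq_basis_det, ← detForm_eq_basis_det, detForm_stdFrame, mul_one] at this
  exact this

theorem alternatingMap_comp_stdFrame {N : ℕ} (g : EuclideanSpace ℝ (Fin N) [⋀^Fin N]→ₗ[ℝ] ℝ)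
    (L : EuclideanSpace ℝ (Fin N) →L[ℝ] EuclideanSpace ℝ (Fin N)) :
    g (fun i => L (stdFrame N i)) = L.det * g (stdFrame N) := by
  rw [alternatingMap_eq_detForm, detForm_comp_stdFrame]

variable {N h k : ℕ} (hk : h + k = N)

/-- The tuple `(u, v)`. -/
def joinFrame {E : Type*} (u : Fin h → E) (v : Fin k → E) (i : Fin N) : E :=
  Fin.append u v (Fin.cast hk.symm i)

theorem joinFrame_left {E : Type*} (u : Fin h → E) (v : Fin k → E) (i : Fin h) :
    joinFrame hk u v (Fin.cast hk (Fin.castAdd k i)) = u i := by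
  simp [joinFrame]

theorem joinFrame_right {E : Type*} (u : Fin h → E) (v : Fin k → E) (i : Fin k) :
    joinFrame hk u v (Fin.cast hk (Fin.natAdd h i)) = v i := by
  simp [joinFrame]

theorem joinFrame_update {E : Type*} (u : Fin h → E) (v : Fin k → E) (i : Fin k) (x : E) :
    joinFrame hk u (Function.update v i x) =
      Function.update (joinFrame hk u v) (Fin.cast hk (Fin.natAdd h i)) x := by
  subst hk
  ext1 j
  induction j using Fin.addCases with
  | left j =>
    rw [Function.update_of_ne]
    · simp [joinFrame]
    · simp [Fin.ext_iff]; omega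
  | right j =>
    by_cases hj : j = i
    · subst hj; simp [joinFrame]
    · simp [joinFrame, hj]

/-- The alternating map `v ↦ det (u, v)`. -/
def detJoin (u : Fin h → EuclideanSpace ℝ (Fin N)) :
    EuclideanSpace ℝ (Fin N) [⋀^Fin k]→ₗ[ℝ] ℝ where
  toFun v := detForm N (joinFrame hk u v)
  map_update_add' v i x y := by
    have e : ‹DecidableEq (Fin k)› = instDecidableEqFin k := Subsingleton.elim _ _
    subst e
    simp only [joinFrame_update, ContinuousAlternatingMap.map_update_add]
  map_update_smul' v i c x := by
    have e : ‹DecidableEq (Fin k)› = instDecidableEqFin k := Subsingleton.elim _ _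
    subst e
    simp only [joinFrame_update, ContinuousAlternatingMap.map_update_smul]
  map_eq_zero_of_eq' v i j hv hij := by
    refine (detForm N).map_eq_zero_of_eq _ (i := Fin.cast hk (Fin.natAdd h i))
      (j := Fin.cast hk (Fin.natAdd h j)) ?_ ?_
    · rw [joinFrame_right, joinFrame_right, hv]
    · simpa [Fin.ext_iff] using hij

/-- The functional `η ↦ (A^* (dy₁ ∧ ⋯ ∧ dy_h) ∧ η)(e₁, …, e_N)`. -/
def fibreDensity (A : EuclideanSpace ℝ (Fin N) →L[ℝ] EuclideanSpace ℝ (Fin h)) :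
    (EuclideanSpace ℝ (Fin N) [⋀^Fin k]→L[ℝ] ℝ) →L[ℝ] ℝ :=
  (ContinuousAlternatingMap.apply ℝ (EuclideanSpace ℝ (Fin N)) ℝ (stdFrame N)).comp
    (wedgeL hk ((detForm h).compContinuousLinearMap A))

theorem fibreDensity_apply (A : EuclideanSpace ℝ (Fin N) →L[ℝ] EuclideanSpace ℝ (Fin h))
    (η : EuclideanSpace ℝ (Fin N) [⋀^Fin k]→L[ℝ] ℝ) :
    fibreDensity hk A η = wedge hk ((detForm h).compContinuousLinearMap A) η (stdFrame N) := rfl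

theorem continuous_fibreDensity : Continuous (fibreDensity hk :
    (EuclideanSpace ℝ (Fin N) →L[ℝ] EuclideanSpace ℝ (Fin h)) → _) := by
  have h1 : Continuous fun A : EuclideanSpace ℝ (Fin N) →L[ℝ] EuclideanSpace ℝ (Fin h) =>
      (detForm h).compContinuousLinearMap A := by
    have := ContinuousAlternatingMap.continuous_compContinuousLinearMapCLM (𝕜 := ℝ)
      (E := EuclideanSpace ℝ (Fin N)) (F := EuclideanSpace ℝ (Fin h)) (G := ℝ) (ι := Fin h)
    exact this.clm_apply continuous_const
  have h2 : Continuous fun α : EuclideanSpace ℝ (Fin N) [⋀^Fin h]→L[ℝ] ℝ =>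
      wedgeL (b := k) hk α := ContinuousLinearMap.continuous _
  exact continuous_const.clm_comp (h2.comp h1)

/-- On the kernel of `A`, a `k`-form is its density times the determinant. -/
theorem apply_eq_detForm_mul_fibreDensity
    (A : EuclideanSpace ℝ (Fin N) →L[ℝ] EuclideanSpace ℝ (Fin h))
    (η : EuclideanSpace ℝ (Fin N) [⋀^Fin k]→L[ℝ] ℝ)
    (u : Fin h → EuclideanSpace ℝ (Fin N)) (v : Fin k → EuclideanSpace ℝ (Fin N))
    (hu : ∀ i, A (u i) = EuclideanSpace.single i 1) (hv : ∀ i, A (v i) = 0) :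
    η v = detForm N (joinFrame hk u v) * fibreDensity hk A η := by
  -- `(A^* det ∧ η)(u, v)` is computed twice: as a top-degree form it is `det (u, v)` times its
  -- value on the standard frame, and by blocks it is `1 · η(v)`, since `A` kills `v`.
  have h1 := alternatingMap_eq_detForm
    (wedge hk ((detForm h).compContinuousLinearMap A) η).toAlternatingMap (joinFrame hk u v)
  simp only [ContinuousAlternatingMap.coe_toAlternatingMap] at h1
  rw [fibreDensity_apply, ← h1, wedge_eq_mul_of_left]
  · simp only [joinFrame_left, joinFrame_right]
    have h2 : (detForm h).compContinuousLinearMap A (fun i => u i) = 1 := by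
      rw [ContinuousAlternatingMap.compContinuousLinearMap_apply, ← detForm_stdFrame h]
      congr 1
      ext1 i
      exact hu i
    rw [h2, one_mul]
  · intro t i j hij _
    rw [joinFrame_right] at hij
    rw [ContinuousAlternatingMap.compContinuousLinearMap_apply]
    apply (detForm h).map_coord_zero i
    rw [Function.comp_apply, hij, hv]

end Density

/-! ### Constant forms dual to part of a frame. -/

section DualForms

variable {E : Type*} [NormedAddCommGroup E] [NormedSpace ℝ E] [FiniteDimensional ℝ E]

theorem exists_clm_of_linearIndependent {F ι : Type*} [NormedAddCommGroup F] [NormedSpace ℝ F]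
    {v : ι → E} (hv : LinearIndependent ℝ v) (c : ι → F) :
    ∃ C : E →L[ℝ] F, ∀ i, C (v i) = c i := by
  obtain ⟨g, hg⟩ := LinearMap.exists_extend ((Module.Basis.span hv).constr ℝ c)
  refine ⟨LinearMap.toContinuousLinearMap g, fun i => ?_⟩
  have h1 : (Module.Basis.span hv i : E) = v i := by rw [Module.Basis.span_apply]
  have h2 := LinearMap.congr_fun hg (Module.Basis.span hv i)
  rw [LinearMap.comp_apply, Module.Basis.constr_basis] at h2
  rw [← h2, Submodule.subtype_apply, h1]
  rfl

/-- For linearly independent vectors there is a form that is `1` on the last block and is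
annihilated by the vectors of the first block. -/
theorem exists_dual_form {a b c : ℕ} (h : a + b = c) {v : Fin c → E}
    (hv : LinearIndependent ℝ v) : ∃ β : E [⋀^Fin b]→L[ℝ] ℝ,
      β (fun i => v (Fin.cast h (Fin.natAdd a i))) = 1 ∧
      ∀ (t : Fin b → E) (i : Fin b) (j : Fin a), t i = v (Fin.cast h (Fin.castAdd b j)) →
        β t = 0 := by
  obtain ⟨C, hC⟩ := exists_clm_of_linearIndependent hv
    (joinFrame h (fun _ => (0 : EuclideanSpace ℝ (Fin b))) (stdFrame b))
  refine ⟨(detForm b).compContinuousLinearMap C, ?_, fun t i j hij => ?_⟩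
  · rw [ContinuousAlternatingMap.compContinuousLinearMap_apply, ← detForm_stdFrame b]
    congr 1
    ext1 i
    rw [Function.comp_apply, hC, joinFrame_right]
  · rw [ContinuousAlternatingMap.compContinuousLinearMap_apply]
    apply (detForm b).map_coord_zero i
    rw [Function.comp_apply, hij, hC, joinFrame_left]

end DualForms

/-! ### Orientation of the fibres is independent of the lift. -/

section Orientation

variable {n h k : ℕ} (hk : h + k = 2 * n + 1)

theorem levelSetOrientation_iff (f : Heis n → EuclideanSpace ℝ (Fin h)) (p : Heis n)
    (v : Fin k → Heis n) : levelSetOrientation hk f p v ↔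
      ∀ u : Fin h → Heis n, (∀ i, fderiv ℝ f p (u i) = EuclideanSpace.single i 1) →
        0 < detForm (2 * n + 1) (joinFrame hk u v) := by
  simp only [levelSetOrientation, detForm_apply, joinFrame]

/-- The orientation of a frame of `ker df_p` may be tested on a single lift of the standard
basis. -/
theorem levelSetOrientation_of_exists (f : Heis n → EuclideanSpace ℝ (Fin h)) (p : Heis n)
    (v : Fin k → Heis n) (hv : ∀ i, fderiv ℝ f p (v i) = 0) (u : Fin h → Heis n)
    (hu : ∀ i, fderiv ℝ f p (u i) = EuclideanSpace.single i 1)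
    (hpos : 0 < detForm (2 * n + 1) (joinFrame hk u v)) : levelSetOrientation hk f p v := by
  rw [levelSetOrientation_iff]
  intro u' hu'
  have hli : LinearIndependent ℝ (joinFrame hk u v) := by
    by_contra hc
    exact hpos.ne' ((detForm (2 * n + 1)).toAlternatingMap.map_linearDependent _ hc)
  obtain ⟨η, hη, -⟩ := exists_dual_form hk hli
  simp only [joinFrame_right] at hη
  have h1 := apply_eq_detForm_mul_fibreDensity hk _ η u v hu hv
  have h2 := apply_eq_detForm_mul_fibreDensity hk _ η u' v hu' hv
  rw [show (fun i => v i) = v from rfl] at hη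
  rw [hη] at h1 h2
  have h3 : 0 < fibreDensity hk (fderiv ℝ f p) η := by
    by_contra hc
    push Not at hc
    have := mul_nonpos_of_nonneg_of_nonpos hpos.le hc
    linarith
  by_contra hc
  push Not at hc
  have := mul_nonpos_of_nonpos_of_nonneg hc h3.le
  linarith

end Orientation

/-! ### The splitting `ℝʰ × ℝᵏ ≃ ℝᴺ` and positive linear coordinates. -/

section AppendEquiv

variable {N h k : ℕ} (hk : h + k = N)

/-- The isometry `ℝʰ × ℝᵏ ≃ ℝ^{h+k}`. -/
def appendIsometry : WithLp 2 (EuclideanSpace ℝ (Fin h) × EuclideanSpace ℝ (Fin k)) ≃ₗᵢ[ℝ]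
    EuclideanSpace ℝ (Fin N) :=
  (PiLp.sumPiLpEquivProdLpPiLp (𝕜 := ℝ) 2 (fun _ : Fin h ⊕ Fin k => ℝ)).symm.trans
    (LinearIsometryEquiv.piLpCongrLeft 2 ℝ ℝ (finSumFinEquiv.trans (finCongr hk)))

/-- The linear isomorphism `ℝʰ × ℝᵏ ≃ ℝ^{h+k}`. -/
def appendEquiv : (EuclideanSpace ℝ (Fin h) × EuclideanSpace ℝ (Fin k)) ≃L[ℝ]
    EuclideanSpace ℝ (Fin N) :=
  (WithLp.prodContinuousLinearEquiv 2 ℝ _ _).symm.trans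
    (appendIsometry hk).toContinuousLinearEquiv

/-- The product carries the sup norm, so `appendEquiv` is not an isometry; it is one after passing
to the `L²` product norm, a change that preserves volume. -/
theorem measurePreserving_appendEquiv : MeasurePreserving (appendEquiv hk) :=
  (appendIsometry hk).measurePreserving.comp (WithLp.volume_preserving_toLp _ _)

theorem appendEquiv_left (q : EuclideanSpace ℝ (Fin h) × EuclideanSpace ℝ (Fin k)) (i : Fin h) :
    appendEquiv hk q (Fin.cast hk (Fin.castAdd k i)) = q.1 i := by
  subst hk
  simp [appendEquiv, appendIsometry, Equiv.piCongrLeft', WithLp.prodContinuousLinearEquiv]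
  rfl

theorem appendEquiv_right (q : EuclideanSpace ℝ (Fin h) × EuclideanSpace ℝ (Fin k)) (i : Fin k) :
    appendEquiv hk q (Fin.cast hk (Fin.natAdd h i)) = q.2 i := by
  subst hk
  simp [appendEquiv, appendIsometry, Equiv.piCongrLeft', WithLp.prodContinuousLinearEquiv]
  rfl

theorem appendEquiv_symm_fst (x : EuclideanSpace ℝ (Fin N)) (i : Fin h) :
    ((appendEquiv hk).symm x).1 i = x (Fin.cast hk (Fin.castAdd k i)) := by
  rw [← appendEquiv_left hk, ContinuousLinearEquiv.apply_symm_apply]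

theorem appendEquiv_symm_stdFrame (i : Fin N) : (appendEquiv hk).symm (stdFrame N i) =
    joinFrame hk (fun i => (stdFrame h i, 0)) (fun j => (0, stdFrame k j)) i := by
  rw [ContinuousLinearEquiv.symm_apply_eq]
  subst hk
  ext j
  induction i using Fin.addCases with
  | left i =>
    have := joinFrame_left rfl (fun i => (stdFrame h i, (0 : EuclideanSpace ℝ (Fin k))))
      (fun j => (0, stdFrame k j)) i
    simp only [Fin.cast_eq_self] at this
    rw [this]
    induction j using Fin.addCases with
    | left j =>
      have := appendEquiv_left rfl (stdFrame h i, (0 : EuclideanSpace ℝ (Fin k))) j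
      simp only [Fin.cast_eq_self] at this
      rw [this]
      simp [stdFrame]
    | right j =>
      have := appendEquiv_right rfl (stdFrame h i, (0 : EuclideanSpace ℝ (Fin k))) j
      simp only [Fin.cast_eq_self] at this
      rw [this]
      simp [stdFrame, Fin.ext_iff]
      omega
  | right i =>
    have := joinFrame_right rfl (fun i => (stdFrame h i, (0 : EuclideanSpace ℝ (Fin k))))
      (fun j => (0, stdFrame k j)) i
    simp only [Fin.cast_eq_self] at this
    rw [this]
    induction j using Fin.addCases with
    | left j =>
      have := appendEquiv_left rfl ((0 : EuclideanSpace ℝ (Fin h)), stdFrame k i) j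
      simp only [Fin.cast_eq_self] at this
      rw [this]
      simp [stdFrame, Fin.ext_iff]
      omega
    | right j =>
      have := appendEquiv_right rfl ((0 : EuclideanSpace ℝ (Fin h)), stdFrame k i) j
      simp only [Fin.cast_eq_self] at this
      rw [this]
      simp [stdFrame]

/-- Links the frame determinant that defines orientation with the Jacobian determinant of the change
of variables. -/
theorem detForm_joinFrame_eq_det
    (T : EuclideanSpace ℝ (Fin h) × EuclideanSpace ℝ (Fin k) →L[ℝ] EuclideanSpace ℝ (Fin N)) :
    detForm N (joinFrame hk (fun i => T (stdFrame h i, 0)) (fun j => T (0, stdFrame k j))) =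
      (T.comp (appendEquiv hk).symm.toContinuousLinearMap).det := by
  rw [← detForm_comp_stdFrame]
  congr 1
  ext1 i
  rw [ContinuousLinearMap.comp_apply, ContinuousLinearEquiv.coe_coe, appendEquiv_symm_stdFrame]
  subst hk
  induction i using Fin.addCases with
  | left i => simp [joinFrame]
  | right i => simp [joinFrame]

/-- The reflection of `ℝᴺ` in the `i`-th coordinate. -/
theorem exists_reflection (i : Fin N) :
    ∃ R : EuclideanSpace ℝ (Fin N) ≃L[ℝ] EuclideanSpace ℝ (Fin N),
      (∀ x j, j ≠ i → R x j = x j) ∧ R.symm = R ∧ R.toContinuousLinearMap.det = -1 := by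
  let R := (ℝ ∙ stdFrame N i)ᗮ.reflection
  have hRi : R (stdFrame N i) = -stdFrame N i :=
    Submodule.reflection_orthogonalComplement_singleton_eq_neg _
  have hRj : ∀ j, j ≠ i → R (stdFrame N j) = stdFrame N j := by
    intro j hj
    apply Submodule.reflection_mem_subspace_eq_self
    rw [Submodule.mem_orthogonal_singleton_iff_inner_right]
    simp [stdFrame, EuclideanSpace.inner_single_left, hj.symm]
  refine ⟨R.toContinuousLinearEquiv, ?_, ?_, ?_⟩
  · intro x j hj
    show R x j = x j
    have hx : x = ∑ l, x l • stdFrame N l := by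
      have := (EuclideanSpace.basisFun (Fin N) ℝ).sum_repr x
      simpa [stdFrame] using this.symm
    conv_lhs => rw [hx]
    rw [map_sum, WithLp.ofLp_sum, Finset.sum_apply, Finset.sum_eq_single j]
    · rw [map_smul, hRj j hj]
      simp [stdFrame]
    · intro l _ hl
      rw [map_smul]
      by_cases hli : l = i
      · subst hli
        rw [hRi]
        simp [stdFrame, hj]
      · rw [hRj l hli]
        simp [stdFrame, hl.symm]
    · simp
  · ext x
    rfl
  · rw [← detForm_comp_stdFrame]
    have h1 : (fun j => R.toContinuousLinearEquiv.toContinuousLinearMap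
        (stdFrame N j)) = Function.update (stdFrame N) i ((-1 : ℝ) • stdFrame N i) := by
      ext1 j
      by_cases hj : j = i
      · subst hj
        rw [Function.update_self, neg_one_smul]
        exact hRi
      · rw [Function.update_of_ne hj]
        exact hRj j hj
    rw [h1, ContinuousAlternatingMap.map_update_smul, Function.update_eq_self, detForm_stdFrame]
    simp

/-- A surjective linear map is, in suitable linear coordinates of positive determinant, the
projection to the first factor. -/
theorem exists_positive_coordinates (hkpos : 0 < k)
    (A : EuclideanSpace ℝ (Fin N) →L[ℝ] EuclideanSpace ℝ (Fin h))
    (hA : Function.Surjective A) :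
    ∃ L : EuclideanSpace ℝ (Fin N) ≃L[ℝ]
      EuclideanSpace ℝ (Fin h) × EuclideanSpace ℝ (Fin k), (∀ v, (L v).1 = A v) ∧
      0 < (L.symm.toContinuousLinearMap.comp (appendEquiv hk).symm.toContinuousLinearMap).det := by
  have hdim : Module.finrank ℝ (LinearMap.ker A.toLinearMap) =
      Module.finrank ℝ (EuclideanSpace ℝ (Fin k)) := by
    have h1 := LinearMap.finrank_range_add_finrank_ker A.toLinearMap
    rw [LinearMap.range_eq_top.2 hA, finrank_top, finrank_euclideanSpace_fin,
      finrank_euclideanSpace_fin] at h1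
    rw [finrank_euclideanSpace_fin]
    omega
  -- `g` extends an isomorphism of `ker A` with `ℝᵏ`, so `(A, g)` is injective, hence bijective by
  -- dimension.
  obtain ⟨g, hg⟩ := LinearMap.exists_extend
    (LinearEquiv.ofFinrankEq _ _ hdim).toLinearMap
  have hinj : Function.Injective (A.toLinearMap.prod g) := by
    rw [← LinearMap.ker_eq_bot, LinearMap.ker_eq_bot']
    intro v hv
    have hv1 : A v = 0 := congrArg Prod.fst hv
    have hv2 : g v = 0 := congrArg Prod.snd hv
    have h2 := LinearMap.congr_fun hg ⟨v, hv1⟩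
    rw [LinearMap.comp_apply, Submodule.subtype_apply] at h2
    have h3 : LinearEquiv.ofFinrankEq _ _ hdim ⟨v, hv1⟩ = 0 := h2.symm.trans hv2
    rw [LinearEquiv.map_eq_zero_iff] at h3
    exact congrArg Subtype.val h3
  have hfr : Module.finrank ℝ (EuclideanSpace ℝ (Fin N)) =
      Module.finrank ℝ (EuclideanSpace ℝ (Fin h) × EuclideanSpace ℝ (Fin k)) := by
    simp [hk]
  let L₀ := (LinearEquiv.ofInjectiveOfFinrankEq _ hinj hfr).toContinuousLinearEquiv
  have hL₀ : ∀ v, (L₀ v).1 = A v := fun v => rfl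
  have hne : (L₀.symm.toContinuousLinearMap.comp (appendEquiv hk).symm.toContinuousLinearMap).det ≠ 0 := by
    have := (((appendEquiv hk).symm.trans L₀.symm).toLinearEquiv.isUnit_det').ne_zero
    exact this
  rcases lt_or_gt_of_ne hne with hneg | hpos
  swap
  · exact ⟨L₀, hL₀, hpos⟩
  -- A wrong sign is corrected by reflecting one of the last `k` coordinates, which leaves the
  -- component `A v` alone; this is where `k > 0` is needed.
  obtain ⟨R, hR, hRs, hRdet⟩ := exists_reflection (Fin.cast hk (Fin.natAdd h (⟨0, hkpos⟩ : Fin k)))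
  refine ⟨((L₀.trans (appendEquiv hk)).trans R).trans (appendEquiv hk).symm, fun v => ?_, ?_⟩
  · ext i
    show ((appendEquiv hk).symm (R (appendEquiv hk (L₀ v)))).1 i = A v i
    rw [appendEquiv_symm_fst, hR, appendEquiv_left, hL₀]
    simp [Fin.ext_iff]
    omega
  · have h1 : (((((L₀.trans (appendEquiv hk)).trans R).trans (appendEquiv hk).symm).symm
        ).toContinuousLinearMap.comp (appendEquiv hk).symm.toContinuousLinearMap) =
        (L₀.symm.toContinuousLinearMap.comp (appendEquiv hk).symm.toContinuousLinearMap).comp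
          R.toContinuousLinearMap := by
      ext1 x
      simp [hRs]
    rw [h1, ContinuousLinearMap.det, ContinuousLinearMap.toLinearMap_comp, LinearMap.det_comp]
    show 0 < ContinuousLinearMap.det _ * ContinuousLinearMap.det _
    rw [hRdet]
    linarith

end AppendEquiv

/-! ### Charts straightening `f`, and the submanifold structure of its fibres. -/

section FibreChart

variable {n h k : ℕ} (hk : h + k = 2 * n + 1) (U : TopologicalSpace.Opens (Heis n))
  (f : Heis n → EuclideanSpace ℝ (Fin h))

/-- A chart of `U` in which `f` is the projection to the first factor, positively oriented. -/
structure IsFibreChart (e : OpenPartialHomeomorph (Heis n)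
    (EuclideanSpace ℝ (Fin h) × EuclideanSpace ℝ (Fin k))) : Prop where
  source_subset : e.source ⊆ U
  fst_eq : ∀ p ∈ e.source, (e p).1 = f p
  contDiffOn : ContDiffOn ℝ ∞ e e.source
  contDiffOn_symm : ContDiffOn ℝ ∞ e.symm e.target
  det_pos : ∀ q ∈ e.target,
    0 < ((fderiv ℝ e.symm q).comp (appendEquiv hk).symm.toContinuousLinearMap).det

/-- The two composites are mutually inverse, so their determinants have product `1`. -/
theorem det_comp_pos_of_symm {V W : Type*} [NormedAddCommGroup V] [NormedSpace ℝ V]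
    [NormedAddCommGroup W] [NormedSpace ℝ W] (L : V ≃L[ℝ] W) (κ : W ≃L[ℝ] V)
    (hpos : 0 < (L.symm.toContinuousLinearMap.comp κ.symm.toContinuousLinearMap).det) :
    0 < (κ.toContinuousLinearMap.comp L.toContinuousLinearMap).det := by
  have h1 : (L.symm.toContinuousLinearMap.comp κ.symm.toContinuousLinearMap).comp
      (κ.toContinuousLinearMap.comp L.toContinuousLinearMap) = ContinuousLinearMap.id ℝ V := by
    ext x; simp
  have h2 := congrArg ContinuousLinearMap.det h1
  rw [ContinuousLinearMap.det, ContinuousLinearMap.toLinearMap_comp, LinearMap.det_comp] at h2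
  change ContinuousLinearMap.det _ * ContinuousLinearMap.det _ = LinearMap.det LinearMap.id at h2
  rw [LinearMap.det_id] at h2
  by_contra hc
  push Not at hc
  have := mul_nonpos_of_nonneg_of_nonpos hpos.le hc
  linarith

variable {U f}

/-- The inverse function theorem for `G = (f, L₂)`, where `L = (df_{p₀}, L₂)` is a positive linear
coordinate system; by this choice the derivative of `G` at `p₀` is `L` itself. -/
theorem exists_fibreChart (hkpos : 0 < k) (hf : ContDiffOn ℝ ∞ f U)
    (hsurj : ∀ p ∈ U, Function.Surjective (fderiv ℝ f p)) {p₀ : Heis n} (hp₀ : p₀ ∈ U) :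
    ∃ e, IsFibreChart hk U f e ∧ p₀ ∈ e.source := by
  obtain ⟨L, hL1, hL2⟩ := exists_positive_coordinates hk hkpos _ (hsurj p₀ hp₀)
  let G : Heis n → EuclideanSpace ℝ (Fin h) × EuclideanSpace ℝ (Fin k) := fun p => (f p, (L p).2)
  have hfat : ∀ p ∈ U, ContDiffAt ℝ ∞ f p := fun p hp => hf.contDiffAt (U.isOpen.mem_nhds hp)
  have hG : ∀ p ∈ U, ContDiffAt ℝ ∞ G p := fun p hp =>
    (hfat p hp).prodMk (contDiffAt_snd.comp p L.contDiff.contDiffAt)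
  have hGd : HasFDerivAt G L.toContinuousLinearMap p₀ := by
    have h1 := ((hfat p₀ hp₀).differentiableAt (by simp)).hasFDerivAt.prodMk
      ((ContinuousLinearMap.snd ℝ _ _).hasFDerivAt.comp p₀ L.hasFDerivAt)
    convert! h1 using 1
    ext1 v
    exact Prod.ext (hL1 v) rfl
  let κ := appendEquiv hk
  -- On `S` the Jacobian determinant of `G` is positive. This gives invertibility of the derivative,
  -- hence smoothness of the inverse at every point of the chart, and the orientation.
  let S : Set (Heis n) := U ∩ {p | 0 < (κ.toContinuousLinearMap.comp (fderiv ℝ G p)).det}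
  have hGon : ContDiffOn ℝ ∞ G U := fun p hp => (hG p hp).contDiffWithinAt
  have hSo : IsOpen S := by
    have hc : ContinuousOn (fun p => (κ.toContinuousLinearMap.comp (fderiv ℝ G p)).det) U := by
      refine ContinuousLinearMap.continuous_det.comp_continuousOn ?_
      exact continuousOn_const.clm_comp (hGon.continuousOn_fderiv_of_isOpen U.isOpen (by simp))
    exact hc.isOpen_inter_preimage U.isOpen isOpen_Ioi
  let e := ((hG p₀ hp₀).toOpenPartialHomeomorph G hGd (by simp)).restrOpen S hSo
  have heG : ∀ p, e p = G p := fun p => rfl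
  have hes : ∀ p ∈ e.source, p ∈ S := fun p hp => hp.2
  have hinv : ∀ p ∈ e.source, ∃ Λ : Heis n ≃L[ℝ] _, HasFDerivAt e Λ.toContinuousLinearMap p ∧
      0 < (κ.toContinuousLinearMap.comp Λ.toContinuousLinearMap).det := by
    intro p hp
    have hdet : 0 < (κ.toContinuousLinearMap.comp (fderiv ℝ G p)).det := (hes p hp).2
    let Λ' := ContinuousLinearMap.toContinuousLinearEquivOfDetNeZero _ (ne_of_gt hdet)
    have e1 : (Λ'.trans κ.symm).toContinuousLinearMap = fderiv ℝ G p := by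
      ext1 v
      show κ.symm (κ (fderiv ℝ G p v)) = _
      simp
    refine ⟨Λ'.trans κ.symm, ?_, ?_⟩
    · rw [e1]
      exact ((hG p (hes p hp).1).differentiableAt (by simp)).hasFDerivAt
    · rw [e1]
      exact hdet
  refine ⟨e, ⟨fun p hp => (hes p hp).1, fun p _ => rfl, fun p hp => ?_, fun q hq => ?_,
    fun q hq => ?_⟩, ?_⟩
  · exact (hG p (hes p hp).1).contDiffWithinAt
  · obtain ⟨Λ, hΛ, -⟩ := hinv _ (e.map_target hq)
    exact (e.contDiffAt_symm hq hΛ (hG _ (hes _ (e.map_target hq)).1)).contDiffWithinAt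
  · obtain ⟨Λ, hΛ, hdet⟩ := hinv _ (e.map_target hq)
    rw [(e.hasFDerivAt_symm hq hΛ).fderiv]
    refine det_comp_pos_of_symm κ.symm Λ.symm ?_
    simpa using hdet
  · refine ⟨(hG p₀ hp₀).mem_toOpenPartialHomeomorph_source hGd (by simp), hp₀, ?_⟩
    show 0 < (κ.toContinuousLinearMap.comp (fderiv ℝ G p₀)).det
    rw [hGd.fderiv]
    exact det_comp_pos_of_symm L κ hL2

variable {hk} {e : OpenPartialHomeomorph (Heis n)
    (EuclideanSpace ℝ (Fin h) × EuclideanSpace ℝ (Fin k))}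

namespace IsFibreChart

theorem contDiffAt_symm (he : IsFibreChart hk U f e) {q} (hq : q ∈ e.target) :
    ContDiffAt ℝ ∞ e.symm q := he.contDiffOn_symm.contDiffAt (e.open_target.mem_nhds hq)

theorem differentiableAt_symm (he : IsFibreChart hk U f e) {q} (hq : q ∈ e.target) :
    DifferentiableAt ℝ e.symm q := (he.contDiffAt_symm hq).differentiableAt (by simp)

theorem symm_mem (he : IsFibreChart hk U f e) {q} (hq : q ∈ e.target) : e.symm q ∈ U :=
  he.source_subset (e.map_target hq)

theorem apply_symm (he : IsFibreChart hk U f e) {q} (hq : q ∈ e.target) :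
    f (e.symm q) = q.1 := by
  rw [← he.fst_eq _ (e.map_target hq), e.right_inv hq]

theorem fderiv_comp_fderiv_symm (he : IsFibreChart hk U f e) (hf : ContDiffOn ℝ ∞ f U) {q}
    (hq : q ∈ e.target) (x) : fderiv ℝ f (e.symm q) (fderiv ℝ e.symm q x) = x.1 := by
  have h1 : DifferentiableAt ℝ f (e.symm q) :=
    (hf.contDiffAt (U.isOpen.mem_nhds (he.symm_mem hq))).differentiableAt (by simp)
  have h2 := h1.hasFDerivAt.comp q (he.differentiableAt_symm hq).hasFDerivAt
  have h3 : f ∘ e.symm =ᶠ[𝓝 q] Prod.fst :=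
    Filter.eventuallyEq_of_mem (e.open_target.mem_nhds hq) fun q' hq' => he.apply_symm hq'
  have h4 := (h2.congr_of_eventuallyEq h3.symm).unique hasFDerivAt_fst
  exact DFunLike.congr_fun h4 x

/-- The parametrization of a fibre. -/
theorem hasFDerivAt_fibre (he : IsFibreChart hk U f e) {y z} (hq : (y, z) ∈ e.target) :
    HasFDerivAt (fun z => e.symm (y, z))
      ((fderiv ℝ e.symm (y, z)).comp (ContinuousLinearMap.inr ℝ _ _)) z :=
  (he.differentiableAt_symm hq).hasFDerivAt.comp z (hasFDerivAt_prodMk_right y z)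

theorem coordFrame_fibre (he : IsFibreChart hk U f e) {y z} (hq : (y, z) ∈ e.target) :
    coordFrame (fun z => e.symm (y, z)) z =
      fun j => fderiv ℝ e.symm (y, z) (0, stdFrame k j) := by
  ext1 j
  rw [coordFrame, (he.hasFDerivAt_fibre hq).fderiv]
  rfl

theorem fderiv_symm_injective (he : IsFibreChart hk U f e) {q} (hq : q ∈ e.target) :
    Function.Injective (fderiv ℝ e.symm q) := by
  have h1 := he.det_pos q hq
  have h2 : IsUnit ((fderiv ℝ e.symm q).comp
      (appendEquiv hk).symm.toContinuousLinearMap).toLinearMap :=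
    (LinearMap.isUnit_iff_isUnit_det _).2 (IsUnit.mk0 _ (ne_of_gt h1))
  have h3 := ((Module.End.isUnit_iff _).1 h2).injective
  intro x x' hx
  have h4 : (appendEquiv hk) x = (appendEquiv hk) x' := by
    apply h3
    simpa using hx
  exact (appendEquiv hk).injective h4

theorem coordFrame_oriented (he : IsFibreChart hk U f e) (hf : ContDiffOn ℝ ∞ f U) {y z}
    (hq : (y, z) ∈ e.target) : levelSetOrientation hk f (e.symm (y, z))
      (coordFrame (fun z => e.symm (y, z)) z) := by
  rw [he.coordFrame_fibre hq]
  refine levelSetOrientation_of_exists hk f _ _ (fun i => ?_)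
    (fun i => fderiv ℝ e.symm (y, z) (stdFrame h i, 0)) (fun i => ?_) ?_
  · rw [he.fderiv_comp_fderiv_symm hf hq]
  · rw [he.fderiv_comp_fderiv_symm hf hq]
    rfl
  · rw [detForm_joinFrame_eq_det]
    exact he.det_pos _ hq

/-- The pointwise coarea formula: the factor in front of `fibreDensity` is the Jacobian of the
change of variables by `e.symm`. -/
theorem apply_coordFrame (he : IsFibreChart hk U f e) (hf : ContDiffOn ℝ ∞ f U) {y z}
    (hq : (y, z) ∈ e.target) (η : Heis n [⋀^Fin k]→L[ℝ] ℝ) :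
    η (coordFrame (fun z => e.symm (y, z)) z) =
      ((fderiv ℝ e.symm (y, z)).comp (appendEquiv hk).symm.toContinuousLinearMap).det *
        fibreDensity hk (fderiv ℝ f (e.symm (y, z))) η := by
  rw [he.coordFrame_fibre hq, ← detForm_joinFrame_eq_det]
  refine apply_eq_detForm_mul_fibreDensity hk _ η _ _ (fun i => ?_) (fun i => ?_)
  · rw [he.fderiv_comp_fderiv_symm hf hq]
    rfl
  · rw [he.fderiv_comp_fderiv_symm hf hq]

theorem image_fibre (he : IsFibreChart hk U f e) (y : EuclideanSpace ℝ (Fin h)) :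
    (fun z => e.symm (y, z)) '' {z | (y, z) ∈ e.target} = levelSet U f y ∩ e.source := by
  ext p
  constructor
  · rintro ⟨z, hz, rfl⟩
    exact ⟨⟨he.symm_mem hz, he.apply_symm hz⟩, e.map_target hz⟩
  · rintro ⟨⟨_, hp⟩, hpe⟩
    have h1 : (y, (e p).2) = e p := Prod.ext (by rw [he.fst_eq p hpe, hp]) rfl
    refine ⟨(e p).2, ?_, ?_⟩
    · show (y, (e p).2) ∈ e.target
      rw [h1]
      exact e.map_source hpe
    · show e.symm (y, (e p).2) = p
      rw [h1, e.left_inv hpe]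

theorem isLocalParam (he : IsFibreChart hk U f e) (y : EuclideanSpace ℝ (Fin h)) :
    IsLocalParam (levelSet U f y) {z | (y, z) ∈ e.target} (fun z => e.symm (y, z)) where
  isOpen := e.open_target.preimage (by fun_prop)
  smooth := he.contDiffOn_symm.comp (by fun_prop) fun z hz => hz
  immersion z hz := by
    rw [(he.hasFDerivAt_fibre hz).fderiv]
    intro x x' hx
    have := he.fderiv_symm_injective hz hx
    exact (Prod.ext_iff.1 this).2
  embedding := by
    let g : {z | (y, z) ∈ e.target} → e.symm.source := fun z => ⟨(y, z), z.2⟩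
    have hg : IsEmbedding g :=
      IsEmbedding.of_comp (g := fun q : e.symm.source => q.1.2) (by fun_prop) (by fun_prop)
        IsEmbedding.subtypeVal
    exact e.symm.isOpenEmbedding_restrict.isEmbedding.comp hg
  relOpen := ⟨e.source, e.open_source, he.image_fibre y⟩

end IsFibreChart

/-- `f` is constant along curves in the fibre, which gives one direction. For the other, the
straight line through `e p` with velocity `de(v)` stays in the slice over `f p`, as the first
component of `de(v)` is `df(v) = 0`; its image under `e.symm` is the required curve. -/
theorem tangentVectors_levelSet (hk : h + k = 2 * n + 1) (hkpos : 0 < k)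
    (hf : ContDiffOn ℝ ∞ f U) (hsurj : ∀ p ∈ U, Function.Surjective (fderiv ℝ f p)) {p : Heis n}
    (hp : p ∈ U) (v : Heis n) :
    v ∈ tangentVectors (levelSet U f (f p)) p ↔ fderiv ℝ f p v = 0 := by
  have hfd : HasFDerivAt f (fderiv ℝ f p) p :=
    ((hf.contDiffAt (U.isOpen.mem_nhds hp)).differentiableAt (by simp)).hasFDerivAt
  constructor
  · rintro ⟨γ, h0, hM, hγ⟩
    have h1 : HasDerivAt (f ∘ γ) (fderiv ℝ f p v) 0 := by
      rw [← h0] at hfd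
      have := hfd.comp_hasDerivAt 0 hγ
      rwa [h0] at this
    have h2 : f ∘ γ =ᶠ[𝓝 0] fun _ => f p := hM.mono fun s hs => hs.2
    exact (h1.congr_of_eventuallyEq h2.symm).unique (hasDerivAt_const _ _)
  · intro hv
    obtain ⟨e, he, hpe⟩ := exists_fibreChart hk hkpos hf hsurj hp
    have hed : HasFDerivAt e (fderiv ℝ e p) p :=
      ((he.contDiffOn.contDiffAt (e.open_source.mem_nhds hpe)).differentiableAt
        (by simp)).hasFDerivAt
    have hesd := (he.differentiableAt_symm (e.map_source hpe)).hasFDerivAt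
    have hid : fderiv ℝ e.symm (e p) (fderiv ℝ e p v) = v := by
      have h1 : HasFDerivAt (e.symm ∘ e) ((fderiv ℝ e.symm (e p)).comp (fderiv ℝ e p)) p :=
        hesd.comp p hed
      have h2 : e.symm ∘ e =ᶠ[𝓝 p] id :=
        Filter.eventuallyEq_of_mem (e.open_source.mem_nhds hpe) fun q hq => e.left_inv hq
      have h3 := (h1.congr_of_eventuallyEq h2.symm).unique (hasFDerivAt_id p)
      exact DFunLike.congr_fun h3 v
    have hfst : (fderiv ℝ e p v).1 = 0 := by
      have := he.fderiv_comp_fderiv_symm hf (e.map_source hpe) (fderiv ℝ e p v)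
      rw [hid, e.left_inv hpe, hv] at this
      exact this.symm
    have hlin : HasDerivAt (fun s : ℝ => e p + s • fderiv ℝ e p v) (fderiv ℝ e p v) 0 := by
      simpa using ((hasDerivAt_id (0 : ℝ)).smul_const (fderiv ℝ e p v)).const_add (e p)
    refine ⟨fun s => e.symm (e p + s • fderiv ℝ e p v), ?_, ?_, ?_⟩
    · simp [e.left_inv hpe]
    · have hcont : ContinuousAt (fun s : ℝ => e p + s • fderiv ℝ e p v) 0 := hlin.continuousAt
      have hmem : e.target ∈ 𝓝 (e p + (0 : ℝ) • fderiv ℝ e p v) := by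
        simpa using e.open_target.mem_nhds (e.map_source hpe)
      filter_upwards [hcont hmem] with s hs
      refine ⟨he.symm_mem hs, ?_⟩
      rw [he.apply_symm hs, Prod.fst_add, Prod.smul_fst, hfst, smul_zero, add_zero,
        he.fst_eq p hpe]
    · have h1 : HasFDerivAt e.symm (fderiv ℝ e.symm (e p))
          (e p + (0 : ℝ) • fderiv ℝ e p v) := by simpa using hesd
      have := h1.comp_hasDerivAt 0 hlin
      rwa [hid] at this

theorem isSubmanifold_levelSet (hk : h + k = 2 * n + 1) (hkpos : 0 < k)
    (hf : ContDiffOn ℝ ∞ f U) (hsurj : ∀ p ∈ U, Function.Surjective (fderiv ℝ f p))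
    (y : EuclideanSpace ℝ (Fin h)) : IsSubmanifold k (levelSet U f y) := by
  rintro p ⟨hp, rfl⟩
  obtain ⟨e, he, hpe⟩ := exists_fibreChart hk hkpos hf hsurj hp
  have h1 : (f p, (e p).2) = e p := Prod.ext (he.fst_eq p hpe).symm rfl
  refine ⟨_, _, he.isLocalParam (f p), (e p).2, ?_, ?_⟩
  · show (f p, (e p).2) ∈ e.target
    rw [h1]
    exact e.map_source hpe
  · show e.symm (f p, (e p).2) = p
    rw [h1, e.left_inv hpe]

end FibreChart

/-! ### Uniqueness of the integral of a form over an oriented submanifold. -/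

section FormIntegral

variable {E : Type*} [NormedAddCommGroup E] [NormedSpace ℝ E]
  {k : ℕ} {M : Set E} {V V' : Set (EuclideanSpace ℝ (Fin k))}
  {ψ ψ' : EuclideanSpace ℝ (Fin k) → E} {η : E → E [⋀^Fin k]→L[ℝ] ℝ} {g : E → ℝ}

theorem IsLocalParam.mem (hψ : IsLocalParam M V ψ) {u} (hu : u ∈ V) : ψ u ∈ M := by
  obtain ⟨W, -, hW⟩ := hψ.relOpen
  have : ψ u ∈ ψ '' V := ⟨u, hu, rfl⟩
  rw [hW] at this
  exact this.1

theorem IsLocalParam.injOn (hψ : IsLocalParam M V ψ) : InjOn ψ V :=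
  injOn_iff_injective.2 hψ.embedding.injective

theorem IsLocalParam.contDiffAt (hψ : IsLocalParam M V ψ) {u} (hu : u ∈ V) :
    ContDiffAt ℝ ∞ ψ u := hψ.smooth.contDiffAt (hψ.isOpen.mem_nhds hu)

theorem IsLocalParam.hasFDerivAt (hψ : IsLocalParam M V ψ) {u} (hu : u ∈ V) :
    HasFDerivAt ψ (fderiv ℝ ψ u) u :=
  ((hψ.contDiffAt hu).differentiableAt (by simp)).hasFDerivAt

theorem apply_eq_zero_of_notMem_tsupport {p : E} (hp : p ∉ tsupport fun p => g p • η p)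
    (v : Fin k → E) : g p * η p v = 0 := by
  have h1 : g p • η p = 0 := image_eq_zero_of_notMem_tsupport (f := fun p => g p • η p) hp
  have h2 := DFunLike.congr_fun h1 v
  simpa using h2

theorem continuousOn_apply_coordFrame (hV : IsOpen V) (hψ : ContDiffOn ℝ ∞ ψ V)
    (hη : Continuous η) : ContinuousOn (fun u => η (ψ u) (coordFrame ψ u)) V := by
  have h1 : ContinuousOn (fun u => η (ψ u)) V := hη.comp_continuousOn hψ.continuousOn
  have h2 : ContinuousOn (coordFrame ψ) V := by
    rw [continuousOn_pi]
    intro i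
    exact (hψ.continuousOn_fderiv_of_isOpen hV (by simp)).clm_apply continuousOn_const
  exact h1.eval h2

/-- The integrand of a form with compact support in a parametrized patch is integrable. -/
theorem integrableOn_apply_coordFrame (hψ : IsLocalParam M V ψ) (hg : Continuous g)
    (hη : Continuous η) (hc : IsCompact (M ∩ tsupport fun p => g p • η p))
    (hsub : (M ∩ tsupport fun p => g p • η p) ⊆ ψ '' V) :
    IntegrableOn (fun u => g (ψ u) * η (ψ u) (coordFrame ψ u)) V := by
  set K := Subtype.val '' (V.domRestrict ψ ⁻¹' (M ∩ tsupport fun p => g p • η p)) with hK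
  have hKc : IsCompact K := by
    refine IsCompact.image ?_ continuous_subtype_val
    rw [hψ.embedding.isInducing.isCompact_preimage_iff]
    · exact hc
    · rw [range_domRestrict]
      exact hsub
  have hKV : K ⊆ V := by
    rintro _ ⟨u, -, rfl⟩
    exact u.2
  have hcont : ContinuousOn (fun u => g (ψ u) * η (ψ u) (coordFrame ψ u)) V :=
    (hg.comp_continuousOn hψ.smooth.continuousOn).mul
      (continuousOn_apply_coordFrame hψ.isOpen hψ.smooth hη)
  refine ((hcont.mono hKV).integrableOn_compact hKc).of_forall_sdiff_eq_zero
    hψ.isOpen.measurableSet fun u hu => ?_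
  apply apply_eq_zero_of_notMem_tsupport
  intro hc'
  exact hu.2 ⟨⟨u, hu.1⟩, ⟨hψ.mem hu.1, hc'⟩, rfl⟩

theorem tsupport_mul_smul_subset (ρ ρ' : E → ℝ) :
    (tsupport fun p => (ρ p * ρ' p) • η p) ⊆ (tsupport fun p => ρ p • η p) := by
  refine closure_mono fun p hp => ?_
  rw [Function.mem_support] at hp ⊢
  intro hc
  apply hp
  rw [mul_comm, mul_smul, hc, smul_zero]

theorem setIntegral_eq_sum_of_partition {N : ℕ} {ρ : E → ℝ} {ρ' : Fin N → E → ℝ}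
    (hψ : IsLocalParam M V ψ) (hρ : Continuous ρ) (hρ' : ∀ j, Continuous (ρ' j))
    (hη : Continuous η) (hc : IsCompact (M ∩ tsupport fun p => ρ p • η p))
    (hsub : (M ∩ tsupport fun p => ρ p • η p) ⊆ ψ '' V)
    (hsum : ∀ p ∈ M ∩ tsupport η, ∑ j, ρ' j p = 1) :
    ∫ u in V, ρ (ψ u) * η (ψ u) (coordFrame ψ u) =
      ∑ j, ∫ u in V, (ρ (ψ u) * ρ' j (ψ u)) * η (ψ u) (coordFrame ψ u) := by
  rw [← integral_finsetSum]
  · refine setIntegral_congr_fun hψ.isOpen.measurableSet fun u hu => ?_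
    -- The functions `ρ'` need to sum to `1` only on the support of `η`; elsewhere the integrand is
    -- zero anyway.
    by_cases hp : ψ u ∈ tsupport η
    · have := hsum _ ⟨hψ.mem hu, hp⟩
      simp only [← Finset.sum_mul, ← Finset.mul_sum, this, mul_one]
    · have h0 : η (ψ u) = 0 := image_eq_zero_of_notMem_tsupport hp
      simp [h0]
  · intro j _
    have hs := inter_subset_inter_right M (tsupport_mul_smul_subset (η := η) ρ (ρ' j))
    refine integrableOn_apply_coordFrame (g := fun p => ρ p * ρ' j p) hψ (hρ.mul (hρ' j)) hη ?_
      (hs.trans hsub)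
    have : M ∩ tsupport (fun p => (ρ p * ρ' j p) • η p) =
        (M ∩ tsupport fun p => ρ p • η p) ∩ tsupport (fun p => (ρ p * ρ' j p) • η p) := by
      rw [inter_assoc, inter_eq_right.2 (tsupport_mul_smul_subset (η := η) ρ (ρ' j))]
    rw [this]
    exact hc.inter_right (isClosed_tsupport _)

variable [FiniteDimensional ℝ E]

/-- The transition map between two parametrizations is differentiable. -/
theorem exists_transition (hψ : IsLocalParam M V ψ) (hψ' : IsLocalParam M V' ψ') :
    ∃ τ : EuclideanSpace ℝ (Fin k) → EuclideanSpace ℝ (Fin k),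
      ∀ u ∈ V ∩ ψ ⁻¹' (ψ' '' V'), τ u ∈ V' ∧ ψ' (τ u) = ψ u ∧ DifferentiableAt ℝ τ u := by
  classical
  set A := V ∩ ψ ⁻¹' (ψ' '' V') with hA
  have hAo : IsOpen A := by
    obtain ⟨W, hW, hWM⟩ := hψ'.relOpen
    have : A = V ∩ ψ ⁻¹' W := by
      ext u
      simp only [hA, hWM, mem_inter_iff, mem_preimage]
      exact ⟨fun h => ⟨h.1, h.2.2⟩, fun h => ⟨h.1, hψ.mem h.1, h.2⟩⟩
    rw [this]
    exact hψ.smooth.continuousOn.isOpen_inter_preimage hψ.isOpen hW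
  have hex : ∀ u : A, ∃ u' : V', ψ' u' = ψ u := by
    rintro ⟨u, hu, u', hu', h⟩
    exact ⟨⟨u', hu'⟩, h⟩
  choose t ht using hex
  have htc : Continuous t := by
    rw [hψ'.embedding.isInducing.continuous_iff]
    have : V'.domRestrict ψ' ∘ t = A.domRestrict ψ := funext fun u => ht u
    rw [this]
    exact (hψ.smooth.continuousOn.mono inter_subset_left).domRestrict
  let τ : EuclideanSpace ℝ (Fin k) → EuclideanSpace ℝ (Fin k) :=
    fun u => if hu : u ∈ A then t ⟨u, hu⟩ else 0
  have hτ : ∀ u (hu : u ∈ A), τ u = t ⟨u, hu⟩ := fun u hu => dif_pos hu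
  have hτc : ContinuousOn τ A := by
    rw [continuousOn_iff_continuous_domRestrict]
    have : A.domRestrict τ = fun u => (t u : EuclideanSpace ℝ (Fin k)) :=
      funext fun u => hτ u u.2
    rw [this]
    exact continuous_subtype_val.comp htc
  have hτ1 : ∀ u ∈ A, τ u ∈ V' := fun u hu => by rw [hτ u hu]; exact (t _).2
  have hτ2 : ∀ u ∈ A, ψ' (τ u) = ψ u := fun u hu => by rw [hτ u hu]; exact ht _
  refine ⟨τ, fun u hu => ⟨hτ1 u hu, hτ2 u hu, ?_⟩⟩
  have hinj := hψ'.immersion (τ u) (hτ1 u hu)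
  -- So far `τ` is only continuous. A left inverse `C` of `dψ'` makes `C ∘ ψ'` a local
  -- diffeomorphism of `ℝᵏ` with derivative the identity at `τ u`, and near `u` the transition map
  -- is `(C ∘ ψ')⁻¹ ∘ (C ∘ ψ)`.
  obtain ⟨C, hC⟩ := LinearMap.exists_leftInverse_of_injective (fderiv ℝ ψ' (τ u)).toLinearMap
    (LinearMap.ker_eq_bot.2 hinj)
  let C' : E →L[ℝ] EuclideanSpace ℝ (Fin k) := LinearMap.toContinuousLinearMap C
  have hstrict : HasStrictFDerivAt (C' ∘ ψ')
      ((ContinuousLinearEquiv.refl ℝ (EuclideanSpace ℝ (Fin k))).toContinuousLinearMap) (τ u) := by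
    have h1 := C'.hasStrictFDerivAt.comp (τ u)
      ((hψ'.contDiffAt (hτ1 u hu)).hasStrictFDerivAt (by simp))
    convert! h1 using 1
    ext1 x
    exact (LinearMap.congr_fun hC x).symm
  have hloc := hstrict.to_localInverse
  have hleft := hstrict.eventually_left_inverse
  have hτu : ContinuousAt τ u := hτc.continuousAt (hAo.mem_nhds hu)
  have heq : τ =ᶠ[𝓝 u] (hstrict.localInverse (C' ∘ ψ') _ (τ u)) ∘ (C' ∘ ψ) := by
    filter_upwards [hτu hleft, hAo.mem_nhds hu] with v hv hvA
    rw [Function.comp_apply, Function.comp_apply, ← hτ2 v hvA]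
    exact hv.symm
  refine DifferentiableAt.congr_of_eventuallyEq ?_ heq
  have h2 : DifferentiableAt ℝ (C' ∘ ψ) u :=
    C'.differentiableAt.comp u (hψ.hasFDerivAt hu.1).differentiableAt
  refine DifferentiableAt.comp u ?_ h2
  rw [Function.comp_apply, ← hτ2 u hu]
  exact hloc.hasFDerivAt.differentiableAt

variable {o : E → (Fin k → E) → Prop}

/-- Invariance of the integral under change of parametrization. -/
theorem setIntegral_coordFrame_eq (hψ : IsLocalParam M V ψ) (hψ' : IsLocalParam M V' ψ')
    (ho : ∀ p ∈ M, ∀ (B : EuclideanSpace ℝ (Fin k) →L[ℝ] E)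
      (L : EuclideanSpace ℝ (Fin k) →L[ℝ] EuclideanSpace ℝ (Fin k)),
      o p (fun j => B (stdFrame k j)) → o p (fun j => B (L (stdFrame k j))) → 0 < L.det)
    (hψo : ∀ u ∈ V, o (ψ u) (coordFrame ψ u)) (hψo' : ∀ u ∈ V', o (ψ' u) (coordFrame ψ' u))
    (hg : (M ∩ tsupport fun p => g p • η p) ⊆ ψ '' V)
    (hg' : (M ∩ tsupport fun p => g p • η p) ⊆ ψ' '' V') :
    ∫ u in V, g (ψ u) * η (ψ u) (coordFrame ψ u) =
      ∫ u in V', g (ψ' u) * η (ψ' u) (coordFrame ψ' u) := by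
  obtain ⟨τ, hτ⟩ := exists_transition hψ hψ'
  set A := V ∩ ψ ⁻¹' (ψ' '' V') with hA
  have hAo : IsOpen A := by
    obtain ⟨W, hW, hWM⟩ := hψ'.relOpen
    have : A = V ∩ ψ ⁻¹' W := by
      ext u
      simp only [hA, hWM, mem_inter_iff, mem_preimage]
      exact ⟨fun h => ⟨h.1, h.2.2⟩, fun h => ⟨h.1, hψ.mem h.1, h.2⟩⟩
    rw [this]
    exact hψ.smooth.continuousOn.isOpen_inter_preimage hψ.isOpen hW
  have hAo' : τ '' A = V' ∩ ψ' ⁻¹' (ψ '' V) := by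
    ext u'
    constructor
    · rintro ⟨u, hu, rfl⟩
      exact ⟨(hτ u hu).1, u, hu.1, (hτ u hu).2.1.symm⟩
    · rintro ⟨hu', u, hu, huu'⟩
      have huA : u ∈ A := ⟨hu, u', hu', huu'.symm⟩
      exact ⟨u, huA, hψ'.injOn (hτ u huA).1 hu' ((hτ u huA).2.1.trans huu')⟩
  -- Both integrals restrict to the overlap of the patches, since the support of `g η` along `M`
  -- lies in both of them.
  have e1 : ∫ u in V, g (ψ u) * η (ψ u) (coordFrame ψ u) =
      ∫ u in A, g (ψ u) * η (ψ u) (coordFrame ψ u) := by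
    refine setIntegral_eq_of_subset_of_forall_sdiff_eq_zero hψ.isOpen.measurableSet
      inter_subset_left fun u hu => apply_eq_zero_of_notMem_tsupport (fun hc => ?_) _
    exact hu.2 ⟨hu.1, hg' ⟨hψ.mem hu.1, hc⟩⟩
  have e2 : ∫ u in V', g (ψ' u) * η (ψ' u) (coordFrame ψ' u) =
      ∫ u in τ '' A, g (ψ' u) * η (ψ' u) (coordFrame ψ' u) := by
    refine setIntegral_eq_of_subset_of_forall_sdiff_eq_zero hψ'.isOpen.measurableSet ?_
      fun u hu => apply_eq_zero_of_notMem_tsupport (fun hc => ?_) _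
    · rw [hAo']; exact inter_subset_left
    · rw [hAo'] at hu
      exact hu.2 ⟨hu.1, hg ⟨hψ'.mem hu.1, hc⟩⟩
  have hinj : InjOn τ A := fun u hu v hv huv => hψ.injOn hu.1 hv.1 (by
    rw [← (hτ u hu).2.1, ← (hτ v hv).2.1, huv])
  rw [e1, e2, integral_image_eq_integral_abs_det_fderiv_smul volume hAo.measurableSet
    (fun u hu => (hτ u hu).2.2.hasFDerivAt.hasFDerivWithinAt) hinj]
  refine setIntegral_congr_fun hAo.measurableSet fun u hu => ?_
  obtain ⟨h1, h2, h3⟩ := hτ u hu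
  have hchain : fderiv ℝ ψ u = (fderiv ℝ ψ' (τ u)).comp (fderiv ℝ τ u) := by
    have h4 := (hψ'.hasFDerivAt h1).comp u h3.hasFDerivAt
    have h5 : ψ =ᶠ[𝓝 u] ψ' ∘ τ := by
      filter_upwards [hAo.mem_nhds hu] with v hv
      exact (hτ v hv).2.1.symm
    exact (hψ.hasFDerivAt hu.1).unique (h4.congr_of_eventuallyEq h5)
  have hframe : coordFrame ψ u = fun j => fderiv ℝ ψ' (τ u) (fderiv ℝ τ u (stdFrame k j)) := by
    ext1 j
    rw [coordFrame, hchain]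
    rfl
  have hframe' : coordFrame ψ' (τ u) = fun j => fderiv ℝ ψ' (τ u) (stdFrame k j) := rfl
  -- Both coordinate frames are positive, so `ho` removes the absolute value from the Jacobian of
  -- `τ`.
  have hpos : 0 < (fderiv ℝ τ u).det := by
    refine ho (ψ u) (hψ.mem hu.1) (fderiv ℝ ψ' (τ u)) _ ?_ ?_
    · rw [← h2]
      exact hψo' _ h1
    · have := hψo u hu.1
      rwa [hframe] at this
  have hval := alternatingMap_comp_stdFrame
    ((η (ψ u)).toAlternatingMap.compLinearMap (fderiv ℝ ψ' (τ u)).toLinearMap) (fderiv ℝ τ u)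
  change η (ψ u) (fun j => fderiv ℝ ψ' (τ u) (fderiv ℝ τ u (stdFrame k j))) =
    _ * η (ψ u) (fun j => fderiv ℝ ψ' (τ u) (stdFrame k j)) at hval
  simp only [smul_eq_mul]
  rw [abs_of_pos hpos, h2, hframe, hframe', hval]
  ring

/-- The integral of a form over an oriented submanifold is unique. -/
theorem HasFormIntegral.unique (hη : Continuous η)
    (ho : ∀ p ∈ M, ∀ (B : EuclideanSpace ℝ (Fin k) →L[ℝ] E)
      (L : EuclideanSpace ℝ (Fin k) →L[ℝ] EuclideanSpace ℝ (Fin k)),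
      o p (fun j => B (stdFrame k j)) → o p (fun j => B (L (stdFrame k j))) → 0 < L.det)
    {I I' : ℝ} (h : HasFormIntegral M o η I) (h' : HasFormIntegral M o η I') : I = I' := by
  obtain ⟨N, V, ψ, ρ, hψ, hψo, hρ, hs, hsum, rfl⟩ := h
  obtain ⟨N', V', ψ', ρ', hψ', hψo', hρ', hs', hsum', rfl⟩ := h'
  -- Both sums are refined to the products `ρ i * ρ' j`, whose supports lie in the patches of `ψ i`
  -- and of `ψ' j`.
  rw [Finset.sum_congr rfl fun i _ => setIntegral_eq_sum_of_partition (hψ i) (hρ i).continuous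
    (fun j => (hρ' j).continuous) hη (hs i).1 (hs i).2 hsum',
    Finset.sum_congr rfl fun i _ => setIntegral_eq_sum_of_partition (hψ' i) (hρ' i).continuous
    (fun j => (hρ j).continuous) hη (hs' i).1 (hs' i).2 hsum, Finset.sum_comm]
  refine Finset.sum_congr rfl fun j _ => Finset.sum_congr rfl fun i _ => ?_
  simp only [mul_comm (ρ' j _) (ρ i _)]
  refine setIntegral_coordFrame_eq (g := fun p => ρ i p * ρ' j p) (hψ i) (hψ' j) ho (hψo i)
    (hψo' j) ?_ ?_
  · exact (inter_subset_inter_right M (tsupport_mul_smul_subset _ _)).trans (hs i).2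
  · simp only [mul_comm (ρ i _) (ρ' j _)]
    exact (inter_subset_inter_right M (tsupport_mul_smul_subset _ _)).trans (hs' j).2

end FormIntegral

/-- Supplies the orientation hypothesis of `HasFormIntegral.unique`: `v ↦ det (u, v)`, pulled back
by `B`, has top degree on `ℝᵏ`, so `L` scales it by `L.det`. -/
theorem det_pos_of_levelSetOrientation {n h k : ℕ} (hk : h + k = 2 * n + 1)
    (f : Heis n → EuclideanSpace ℝ (Fin h)) (p : Heis n)
    (hsurj : Function.Surjective (fderiv ℝ f p))
    (B : EuclideanSpace ℝ (Fin k) →L[ℝ] Heis n)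
    (L : EuclideanSpace ℝ (Fin k) →L[ℝ] EuclideanSpace ℝ (Fin k))
    (h1 : levelSetOrientation hk f p (fun j => B (stdFrame k j)))
    (h2 : levelSetOrientation hk f p (fun j => B (L (stdFrame k j)))) : 0 < L.det := by
  choose u hu using fun i => hsurj (EuclideanSpace.single i (1 : ℝ))
  have h3 := (levelSetOrientation_iff hk f p _).1 h1 u hu
  have h4 := (levelSetOrientation_iff hk f p _).1 h2 u hu
  have h5 := alternatingMap_comp_stdFrame ((detJoin hk u).compLinearMap B.toLinearMap) L
  change detForm _ (joinFrame hk u fun j => B (L (stdFrame k j))) =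
    L.det * detForm _ (joinFrame hk u fun j => B (stdFrame k j)) at h5
  rw [h5] at h4
  exact pos_of_mul_pos_left h4 h3.le

/-! ### Stokes' theorem in a parametrized patch. -/

section Stokes

/-- Integration by parts against the constant function `1`. -/
theorem integral_fderiv_apply_eq_zero {Z : Type*} [NormedAddCommGroup Z] [NormedSpace ℝ Z]
    [FiniteDimensional ℝ Z] [MeasurableSpace Z] [BorelSpace Z] {μ : Measure Z}
    [μ.IsAddHaarMeasure] {G : Z → ℝ} (hG : ContDiff ℝ ∞ G) (hc : HasCompactSupport G) (v : Z) :
    Integrable (fun z => fderiv ℝ G z v) μ ∧ ∫ z, fderiv ℝ G z v ∂μ = 0 := by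
  have hcont : Continuous fun z => fderiv ℝ G z v :=
    (hG.continuous_fderiv (by simp)).clm_apply continuous_const
  have hcs : HasCompactSupport fun z => fderiv ℝ G z v := hc.fderiv_apply ℝ v
  have hint := hcont.integrable_of_hasCompactSupport hcs (μ := μ)
  refine ⟨hint, ?_⟩
  have := integral_mul_fderiv_eq_neg_fderiv_mul_of_integrable (μ := μ) (f := fun _ : Z => (1 : ℝ))
    (g := G) (v := v) (by simp) (by simpa using hint)
    (by simpa using hG.continuous.integrable_of_hasCompactSupport hc)
    (fun x _ => differentiableAt_const _) (fun x _ => hG.differentiable (by simp) x)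
  simpa using this

variable {E : Type*} [NormedAddCommGroup E] [NormedSpace ℝ E]
  {Z : Type*} [NormedAddCommGroup Z] [NormedSpace ℝ Z]

theorem contDiffAt_pullback_apply {m : ℕ} {ψ : Z → E} {ζ : E → E [⋀^Fin m]→L[ℝ] ℝ} {z : Z}
    (hψ : ContDiffAt ℝ ∞ ψ z) (hζ : ContDiff ℝ ∞ ζ) (w : Fin m → Z) :
    ContDiffAt ℝ ∞ (fun z => ζ (ψ z) (fun j => fderiv ℝ ψ z (w j))) z := by
  have h1 : ContDiffAt ℝ ∞ (fun z => (ζ (ψ z)).toContinuousMultilinearMap) z :=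
    (ContinuousAlternatingMap.toContinuousMultilinearMapCLM ℝ : (E [⋀^Fin m]→L[ℝ] ℝ) →L[ℝ]
      ContinuousMultilinearMap ℝ (fun _ : Fin m => E) ℝ).contDiff.contDiffAt.comp z
      (hζ.contDiffAt.comp z hψ)
  have h2 : ContDiffAt ℝ ∞ (fun z => fun _ : Fin m => fderiv ℝ ψ z) z :=
    contDiffAt_pi.2 fun _ => hψ.fderiv_right (by simp)
  have h3 := ContinuousMultilinearMap.contDiff (𝕜 := ℝ) (ι := Fin m)
    (E := fun _ : Fin m => Z →L[ℝ] E) (F := ContinuousMultilinearMap ℝ (fun _ : Fin m => E) ℝ →L[ℝ]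
      ContinuousMultilinearMap ℝ (fun _ : Fin m => Z) ℝ) (n := ∞)
    (ContinuousMultilinearMap.compContinuousLinearMapContinuousMultilinear ℝ
      (fun _ : Fin m => Z) (fun _ => E) ℝ)
  have h4 := (h3.contDiffAt.comp z h2).clm_apply h1
  exact (ContinuousMultilinearMap.apply ℝ (fun _ : Fin m => Z) ℝ w).contDiff.contDiffAt.comp z h4

/-- Stokes' theorem for the pullback of a form that vanishes near the boundary of the domain. -/
theorem setIntegral_extDeriv_coordFrame {m : ℕ} {V : Set (EuclideanSpace ℝ (Fin (m + 1)))}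
    {ψ : EuclideanSpace ℝ (Fin (m + 1)) → E} {ζ : E → E [⋀^Fin m]→L[ℝ] ℝ} (hV : IsOpen V)
    (hψ : ContDiffOn ℝ ∞ ψ V) (hζ : ContDiff ℝ ∞ ζ)
    {K : Set (EuclideanSpace ℝ (Fin (m + 1)))} (hK : IsCompact K) (hKV : K ⊆ V)
    (hKζ : ∀ z ∈ V, ψ z ∈ tsupport ζ → z ∈ K) :
    ∫ z in V, extDeriv ζ (ψ z) (coordFrame ψ z) = 0 := by
  classical
  have hψat : ∀ z ∈ V, ContDiffAt ℝ ∞ ψ z := fun z hz => hψ.contDiffAt (hV.mem_nhds hz)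
  -- The coefficients of `ψ^*ζ`, extended by zero. The extension is smooth because they vanish off
  -- the compact set `K ⊆ V`.
  let G : Fin (m + 1) → EuclideanSpace ℝ (Fin (m + 1)) → ℝ := fun i =>
    V.indicator fun z => ζ (ψ z) fun j => fderiv ℝ ψ z (i.removeNth (stdFrame (m + 1)) j)
  have hGV : ∀ i, ∀ z ∈ V, G i =ᶠ[𝓝 z]
      fun z => ζ (ψ z) fun j => fderiv ℝ ψ z (i.removeNth (stdFrame (m + 1)) j) := by
    intro i z hz
    filter_upwards [hV.mem_nhds hz] with z' hz'
    exact indicator_of_mem hz' _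
  have hGK : ∀ i, ∀ z ∉ K, G i z = 0 := by
    intro i z hz
    by_cases hzV : z ∈ V
    · have h0 : ζ (ψ z) = 0 := image_eq_zero_of_notMem_tsupport fun hc => hz (hKζ z hzV hc)
      simp [G, h0]
    · exact indicator_of_notMem hzV _
  have hGK' : ∀ i, ∀ z ∉ K, G i =ᶠ[𝓝 z] 0 := by
    intro i z hz
    filter_upwards [hK.isClosed.isOpen_compl.mem_nhds hz] with z' hz'
    exact hGK i z' hz'
  have hGc : ∀ i, HasCompactSupport (G i) := fun i =>
    HasCompactSupport.intro hK fun z hz => hGK i z hz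
  have hGs : ∀ i, ContDiff ℝ ∞ (G i) := by
    intro i
    rw [contDiff_iff_contDiffAt]
    intro z
    by_cases hz : z ∈ V
    · exact (contDiffAt_pullback_apply (hψat z hz) hζ _).congr_of_eventuallyEq (hGV i z hz)
    · exact contDiffAt_const.congr_of_eventuallyEq (hGK' i z fun hc => hz (hKV hc))
  -- `d` commutes with pullback, so the integrand is the divergence `∑ (-1)^i ∂_i G_i`.
  have key : V.indicator (fun z => extDeriv ζ (ψ z) (coordFrame ψ z)) =
      fun z => ∑ i : Fin (m + 1), (-1 : ℝ) ^ (i : ℕ) * fderiv ℝ (G i) z (stdFrame (m + 1) i) := by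
    ext z
    by_cases hz : z ∈ V
    · rw [indicator_of_mem hz]
      have h1 := extDeriv_pullback (hζ.differentiable (by simp) (ψ z)) (hψat z hz)
        (by simpa using WithTop.coe_le_coe.2 (le_top : (2 : ℕ∞) ≤ ⊤))
      have h2 := DFunLike.congr_fun h1 (stdFrame (m + 1))
      rw [ContinuousAlternatingMap.compContinuousLinearMap_apply] at h2
      refine h2.symm.trans ?_
      have hd1 : DifferentiableAt ℝ (fun z => ζ (ψ z)) z :=
        (hζ.differentiable (by simp) (ψ z)).comp z ((hψat z hz).differentiableAt (by simp))
      have hd2 : DifferentiableAt ℝ (fderiv ℝ ψ) z :=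
        ((hψat z hz).fderiv_right (m := ∞) (by simp)).differentiableAt (by simp)
      have hd := (hd1.hasFDerivAt.continuousAlternatingMapCompContinuousLinearMap
        hd2.hasFDerivAt).differentiableAt
      rw [extDeriv_apply hd]
      refine Finset.sum_congr rfl fun i _ => ?_
      rw [(hGV i z hz).fderiv_eq, zsmul_eq_mul]
      push_cast
      rfl
    · rw [indicator_of_notMem hz]
      symm
      refine Finset.sum_eq_zero fun i _ => ?_
      rw [(hGK' i z fun hc => hz (hKV hc)).fderiv_eq]
      simp
  rw [← integral_indicator hV.measurableSet, key, integral_finsetSum]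
  · refine Finset.sum_eq_zero fun i _ => ?_
    rw [integral_const_mul, (integral_fderiv_apply_eq_zero (hGs i) (hGc i) _).2, mul_zero]
  · intro i _
    exact (integral_fderiv_apply_eq_zero (hGs i) (hGc i) _).1.const_mul _

end Stokes

/-! ### Fubini and the coarea formula in fibre charts. -/

section FibreIntegration

variable {n h k : ℕ} {hk : h + k = 2 * n + 1} {U : TopologicalSpace.Opens (Heis n)}
  {f : Heis n → EuclideanSpace ℝ (Fin h)}
  {e : OpenPartialHomeomorph (Heis n) (EuclideanSpace ℝ (Fin h) × EuclideanSpace ℝ (Fin k))}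
  {ζ : Heis n → Heis n [⋀^Fin k]→L[ℝ] ℝ}

/-- The density of the form `ζ` on the fibres of a chart. -/
def fibreIntegrand
    (e : OpenPartialHomeomorph (Heis n) (EuclideanSpace ℝ (Fin h) × EuclideanSpace ℝ (Fin k)))
    (ζ : Heis n → Heis n [⋀^Fin k]→L[ℝ] ℝ) :
    EuclideanSpace ℝ (Fin h) × EuclideanSpace ℝ (Fin k) → ℝ :=
  e.target.indicator fun q => ζ (e.symm q) fun j => fderiv ℝ e.symm q (0, stdFrame k j)

namespace IsFibreChart

theorem integrable_mul_fibreIntegrand (he : IsFibreChart hk U f e) (hζ : Continuous ζ)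
    (hc : HasCompactSupport ζ) (hs : tsupport ζ ⊆ e.source)
    {Φ : EuclideanSpace ℝ (Fin h) → ℝ} (hΦ : Continuous Φ) :
    Integrable fun q => Φ q.1 * fibreIntegrand e ζ q := by
  set K := e '' tsupport ζ with hK
  have hKc : IsCompact K := hc.isCompact.image_of_continuousOn (e.continuousOn.mono hs)
  have hKt : K ⊆ e.target := by
    rintro _ ⟨p, hp, rfl⟩
    exact e.map_source (hs hp)
  have h0 : ∀ q ∉ K, fibreIntegrand e ζ q = 0 := by
    intro q hq
    by_cases hqt : q ∈ e.target
    · have h1 : ζ (e.symm q) = 0 := image_eq_zero_of_notMem_tsupport fun hc' =>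
        hq ⟨e.symm q, hc', e.right_inv hqt⟩
      simp [fibreIntegrand, h1]
    · exact indicator_of_notMem hqt _
  have hcont : ContinuousOn (fun q => Φ q.1 * fibreIntegrand e ζ q) e.target := by
    refine (hΦ.comp continuous_fst).continuousOn.mul ?_
    have h1 : ContinuousOn (fun q => ζ (e.symm q)) e.target :=
      hζ.comp_continuousOn e.continuousOn_symm
    have h2 : ContinuousOn (fun q => fun j : Fin k => fderiv ℝ e.symm q (0, stdFrame k j))
        e.target := continuousOn_pi.2 fun j =>
      (he.contDiffOn_symm.continuousOn_fderiv_of_isOpen e.open_target (by simp)).clm_apply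
        continuousOn_const
    exact (h1.eval h2).congr fun q hq => indicator_of_mem hq _
  rw [← integrableOn_iff_integrable_of_support_subset (s := K)]
  · exact (hcont.mono hKt).integrableOn_compact hKc
  · intro q hq
    by_contra hqK
    exact hq (by simp [h0 q hqK])

theorem integrable_fibreIntegral (he : IsFibreChart hk U f e) (hζ : Continuous ζ)
    (hc : HasCompactSupport ζ) (hs : tsupport ζ ⊆ e.source)
    {Φ : EuclideanSpace ℝ (Fin h) → ℝ} (hΦ : Continuous Φ) :
    Integrable fun y => (∫ z, fibreIntegrand e ζ (y, z)) * Φ y := by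
  have h1 := (he.integrable_mul_fibreIntegrand hζ hc hs hΦ).integral_prod_left
  simpa only [integral_const_mul, mul_comm] using h1

theorem setIntegral_fibre (he : IsFibreChart hk U f e) (y : EuclideanSpace ℝ (Fin h)) :
    ∫ z in {z | (y, z) ∈ e.target}, ζ (e.symm (y, z)) (coordFrame (fun z => e.symm (y, z)) z) =
      ∫ z, fibreIntegrand e ζ (y, z) := by
  have hm : MeasurableSet {z | (y, z) ∈ e.target} :=
    (e.open_target.preimage (by fun_prop)).measurableSet
  rw [← integral_indicator hm]
  congr 1
  ext z
  by_cases hz : (y, z) ∈ e.target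
  · rw [indicator_of_mem (show z ∈ {z | (y, z) ∈ e.target} from hz), fibreIntegrand,
      indicator_of_mem hz, he.coordFrame_fibre hz]
  · rw [indicator_of_notMem (show z ∉ {z | (y, z) ∈ e.target} from hz), fibreIntegrand,
      indicator_of_notMem hz]

/-- The coarea formula in a chart. -/
theorem integral_fibreDensity (he : IsFibreChart hk U f e) (hf : ContDiffOn ℝ ∞ f U)
    (hζ : Continuous ζ) (hc : HasCompactSupport ζ) (hs : tsupport ζ ⊆ e.source)
    {Φ : EuclideanSpace ℝ (Fin h) → ℝ} (hΦ : Continuous Φ) :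
    ∫ p, Φ (f p) * fibreDensity hk (fderiv ℝ f p) (ζ p) =
      ∫ y, (∫ z, fibreIntegrand e ζ (y, z)) * Φ y := by
  set κ := appendEquiv hk with hκ
  set g : Heis n → ℝ := fun p => Φ (f p) * fibreDensity hk (fderiv ℝ f p) (ζ p) with hg
  set S := κ.symm ⁻¹' e.target with hS
  have hSo : IsOpen S := e.open_target.preimage κ.symm.continuous
  have himg : (fun x => e.symm (κ.symm x)) '' S = e.source := by
    ext p
    constructor
    · rintro ⟨x, hx, rfl⟩
      exact e.map_target hx
    · intro hp
      refine ⟨κ (e p), ?_, ?_⟩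
      · show κ.symm (κ (e p)) ∈ e.target
        rw [κ.symm_apply_apply]
        exact e.map_source hp
      · simp [e.left_inv hp]
  have hd : ∀ x ∈ S, HasFDerivWithinAt (fun x => e.symm (κ.symm x))
      ((fderiv ℝ e.symm (κ.symm x)).comp κ.symm.toContinuousLinearMap) S x := fun x hx =>
    ((he.differentiableAt_symm hx).hasFDerivAt.comp x κ.symm.hasFDerivAt).hasFDerivWithinAt
  have hinj : InjOn (fun x => e.symm (κ.symm x)) S := fun x hx x' hx' hxx' =>
    κ.symm.injective (e.symm.injOn hx hx' hxx')
  have e1 : ∫ p, g p = ∫ p in e.source, g p := by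
    refine (setIntegral_eq_integral_of_forall_compl_eq_zero fun p hp => ?_).symm
    have h0 : ζ p = 0 := image_eq_zero_of_notMem_tsupport fun hc' => hp (hs hc')
    simp [hg, h0]
  -- The determinant is positive in a fibre chart, so by `apply_coordFrame` Jacobian times density
  -- is exactly the fibre integrand.
  have e2 : ∫ x in S, |((fderiv ℝ e.symm (κ.symm x)).comp κ.symm.toContinuousLinearMap).det| •
      g (e.symm (κ.symm x)) = ∫ x, (fun q => Φ q.1 * fibreIntegrand e ζ q) (κ.symm x) := by
    rw [← integral_indicator hSo.measurableSet]
    congr 1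
    ext x
    by_cases hx : x ∈ S
    · have hx' : ((κ.symm x).1, (κ.symm x).2) ∈ e.target := hx
      have h1 := he.apply_coordFrame hf hx' (ζ (e.symm (κ.symm x)))
      rw [he.coordFrame_fibre hx'] at h1
      rw [indicator_of_mem hx, abs_of_pos (he.det_pos _ hx)]
      simp only [fibreIntegrand, indicator_of_mem (show κ.symm x ∈ e.target from hx), smul_eq_mul,
        hg]
      rw [he.apply_symm hx]
      simp only [Prod.mk.eta] at h1
      rw [h1]
      ring
    · rw [indicator_of_notMem hx]
      simp only [fibreIntegrand, indicator_of_notMem (show κ.symm x ∉ e.target from hx), mul_zero]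
  have hmp : MeasurePreserving κ.symm :=
    (measurePreserving_appendEquiv hk).symm κ.toHomeomorph.toMeasurableEquiv
  rw [e1, ← himg, integral_image_eq_integral_abs_det_fderiv_smul volume hSo.measurableSet hd hinj,
    e2]
  refine (hmp.integral_comp κ.symm.toHomeomorph.measurableEmbedding
    fun q => Φ q.1 * fibreIntegrand e ζ q).trans ?_
  rw [Measure.volume_eq_prod, integral_prod _ (he.integrable_mul_fibreIntegrand hζ hc hs hΦ)]
  simp only [integral_const_mul, mul_comm]

end IsFibreChart

variable (hk)

theorem exists_fibreChart_partition (hkpos : 0 < k) (hf : ContDiffOn ℝ ∞ f U)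
    (hsurj : ∀ p ∈ U, Function.Surjective (fderiv ℝ f p)) {K : Set (Heis n)} (hK : IsCompact K) (hKU : K ⊆ U) :
    ∃ (N : ℕ) (e : Fin N → OpenPartialHomeomorph (Heis n)
        (EuclideanSpace ℝ (Fin h) × EuclideanSpace ℝ (Fin k))) (ρ : Fin N → Heis n → ℝ),
      (∀ i, IsFibreChart hk U f (e i)) ∧ (∀ i, ContDiff ℝ ∞ (ρ i)) ∧
      (∀ i, tsupport (ρ i) ⊆ (e i).source) ∧ ∀ p ∈ K, ∑ i, ρ i p = 1 := by
  choose c hc hpc using fun p : U => exists_fibreChart hk hkpos hf hsurj p.2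
  obtain ⟨t, ht⟩ := hK.elim_finite_subcover (fun p => (c p).source) (fun p => (c p).open_source)
    fun p hp => mem_iUnion.2 ⟨⟨p, hKU hp⟩, hpc ⟨p, hKU hp⟩⟩
  let σ := t.equivFin
  let e : Fin t.card → _ := fun i => c (σ.symm i)
  obtain ⟨ρ, hρ⟩ := SmoothPartitionOfUnity.exists_isSubordinate (modelWithCornersSelf ℝ (Heis n))
    hK.isClosed (fun i => (e i).source) (fun i => (e i).open_source) (by
      intro p hp
      obtain ⟨x, hx, hpx⟩ := mem_iUnion₂.1 (ht hp)
      refine mem_iUnion.2 ⟨σ ⟨x, hx⟩, ?_⟩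
      simpa [e] using hpx)
  refine ⟨t.card, e, fun i => ρ i, fun i => hc _,
    fun i => (ρ i).contMDiff.contDiff, hρ, fun p hp => ?_⟩
  rw [← finsum_eq_sum_of_fintype]
  exact ρ.sum_eq_one hp

end FibreIntegration

/-! ### The averaged current and the vanishing of its boundary. -/

section AveragedCurrent

/-- The product of a smooth function with a test form. -/
def TestForm.mulLeft {E : Type*} [NormedAddCommGroup E] [NormedSpace ℝ E]
    {U : TopologicalSpace.Opens E} {k : ℕ} (ρ : E → ℝ) (hρ : ContDiff ℝ ∞ ρ) (η : TestForm U k) :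
    TestForm U k where
  toFun p := ρ p • η p
  contDiff' := hρ.smul η.contDiff
  hasCompactSupport' := η.hasCompactSupport.smul_left (f := ρ)
  tsupport_subset' := (tsupport_smul_subset_right ρ η).trans η.tsupport_subset

theorem TestForm.mulLeft_apply {E : Type*} [NormedAddCommGroup E] [NormedSpace ℝ E]
    {U : TopologicalSpace.Opens E} {k : ℕ} (ρ : E → ℝ) (hρ : ContDiff ℝ ∞ ρ) (η : TestForm U k)
    (p : E) : TestForm.mulLeft ρ hρ η p = ρ p • η p := rfl

theorem TestForm.sum_mulLeft {E : Type*} [NormedAddCommGroup E] [NormedSpace ℝ E]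
    {U : TopologicalSpace.Opens E} {k N : ℕ} (ρ : Fin N → E → ℝ) (hρ : ∀ i, ContDiff ℝ ∞ (ρ i))
    (η : TestForm U k) (hsum : ∀ p ∈ tsupport η, ∑ i, ρ i p = 1) :
    ∑ i, TestForm.mulLeft (ρ i) (hρ i) η = η := by
  ext1 p
  have h1 : (∑ i, TestForm.mulLeft (ρ i) (hρ i) η) p = ∑ i, TestForm.mulLeft (ρ i) (hρ i) η p := by
    induction (Finset.univ : Finset (Fin N)) using Finset.induction_on with
    | empty => rfl
    | insert i s hi ih =>
      rw [Finset.sum_insert hi, Finset.sum_insert hi, ← ih]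
      rfl
  rw [h1]
  simp only [TestForm.mulLeft_apply, ← Finset.sum_smul]
  by_cases hp : p ∈ tsupport η
  · rw [hsum p hp, one_smul]
  · rw [image_eq_zero_of_notMem_tsupport hp, smul_zero]

variable {n h k : ℕ} (hk : h + k = 2 * n + 1) (U : TopologicalSpace.Opens (Heis n))
  (f : Heis n → EuclideanSpace ℝ (Fin h)) (Φ : EuclideanSpace ℝ (Fin h) → ℝ)

/-- The current `T_{f,Φ}`, represented by integration against a density. -/
def averagedCurrent : Current U k :=
  TestFunction.integralAgainstBilinCLM (ContinuousLinearMap.apply ℝ ℝ) volume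
    fun p => Φ (f p) • fibreDensity hk (fderiv ℝ f p)

variable {U f Φ}

theorem continuousOn_density (hf : ContDiffOn ℝ ∞ f U) (hΦ : Continuous Φ) :
    ContinuousOn (fun p => Φ (f p) • fibreDensity hk (fderiv ℝ f p)) U :=
  (hΦ.comp_continuousOn hf.continuousOn).smul ((continuous_fibreDensity hk).comp_continuousOn
    (hf.continuousOn_fderiv_of_isOpen U.isOpen (by simp)))

/-- The identification with an actual integral rests on local integrability of the density on `U`,
here a consequence of its continuity. -/
theorem averagedCurrent_apply (hf : ContDiffOn ℝ ∞ f U) (hΦ : Continuous Φ) (η : TestForm U k) :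
    averagedCurrent hk U f Φ η = ∫ p, Φ (f p) * fibreDensity hk (fderiv ℝ f p) (η p) :=
  haveI : SecondCountableTopologyEither (Heis n)
      ((Heis n [⋀^Fin k]→L[ℝ] ℝ) →L[ℝ] ℝ) := secondCountableTopologyEither_of_left _ _
  TestFunction.integralAgainstBilinCLM_eq_integral
    ((continuousOn_density hk hf hΦ).locallyIntegrableOn U.isOpen.measurableSet)

variable {hk}
  {e : OpenPartialHomeomorph (Heis n) (EuclideanSpace ℝ (Fin h) × EuclideanSpace ℝ (Fin k))}

theorem IsFibreChart.averagedCurrent_apply (he : IsFibreChart hk U f e)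
    (hf : ContDiffOn ℝ ∞ f U) (hΦ : Continuous Φ) {ζ : TestForm U k}
    (hs : tsupport ζ ⊆ e.source) :
    averagedCurrent hk U f Φ ζ = ∫ y, (∫ z, fibreIntegrand e ζ (y, z)) * Φ y := by
  rw [Heisenberg.averagedCurrent_apply hk hf hΦ,
    he.integral_fibreDensity hf ζ.continuous ζ.hasCompactSupport hs hΦ]

theorem isCompact_levelSet_inter (hf : ContDiffOn ℝ ∞ f U) {K : Set (Heis n)} (hK : IsCompact K)
    (hKU : K ⊆ U) (y : EuclideanSpace ℝ (Fin h)) : IsCompact (levelSet U f y ∩ K) := by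
  have h1 : levelSet U f y ∩ K = K ∩ f ⁻¹' {y} := by
    ext p
    exact ⟨fun hp => ⟨hp.2, hp.1.2⟩, fun hp => ⟨⟨hKU hp.1, hp.2⟩, hp.1⟩⟩
  rw [h1]
  exact hK.of_isClosed_subset ((hf.continuousOn.mono hKU).preimage_isClosed_of_isClosed
    hK.isClosed isClosed_singleton) inter_subset_left

/-- One family of charts and cut-offs serves all `y` at once, which exhibits the fibre integral as a
finite sum of functions of `y` controlled by Fubini. -/
theorem hasFormIntegral_levelSet (hf : ContDiffOn ℝ ∞ f U) {N : ℕ}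
    {e : Fin N → OpenPartialHomeomorph (Heis n)
      (EuclideanSpace ℝ (Fin h) × EuclideanSpace ℝ (Fin k))} {ρ : Fin N → Heis n → ℝ}
    (he : ∀ i, IsFibreChart hk U f (e i)) (hρ : ∀ i, ContDiff ℝ ∞ (ρ i))
    (hs : ∀ i, tsupport (ρ i) ⊆ (e i).source) (η : TestForm U k)
    (hsum : ∀ p ∈ tsupport η, ∑ i, ρ i p = 1) (y : EuclideanSpace ℝ (Fin h)) :
    HasFormIntegral (levelSet U f y) (levelSetOrientation hk f) η
      (∑ i, ∫ z, fibreIntegrand (e i) (TestForm.mulLeft (ρ i) (hρ i) η) (y, z)) := by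
  refine ⟨N, fun i => {z | (y, z) ∈ (e i).target}, fun i z => (e i).symm (y, z), ρ,
    fun i => (he i).isLocalParam y, fun i z hz => (he i).coordFrame_oriented hf hz, hρ,
    fun i => ⟨?_, ?_⟩, fun p hp => hsum p hp.2, ?_⟩
  · exact isCompact_levelSet_inter hf (TestForm.mulLeft (ρ i) (hρ i) η).hasCompactSupport
      (TestForm.mulLeft (ρ i) (hρ i) η).tsupport_subset y
  · rw [(he i).image_fibre y]
    exact inter_subset_inter_right _ ((tsupport_smul_subset_left (ρ i) η).trans (hs i))
  · refine Finset.sum_congr rfl fun i _ => ?_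
    rw [← (he i).setIntegral_fibre y]
    rfl

theorem existsUnique_hasFormIntegral_levelSet (hkpos : 0 < k) (hf : ContDiffOn ℝ ∞ f U)
    (hsurj : ∀ p ∈ U, Function.Surjective (fderiv ℝ f p)) (η : TestForm U k)
    (y : EuclideanSpace ℝ (Fin h)) :
    ∃! I : ℝ, HasFormIntegral (levelSet U f y) (levelSetOrientation hk f) η I := by
  obtain ⟨N, e, ρ, he, hρ, hs, hsum⟩ := exists_fibreChart_partition hk hkpos hf hsurj
    η.hasCompactSupport η.tsupport_subset
  have h1 := hasFormIntegral_levelSet hf he hρ hs η hsum y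
  refine ⟨_, h1, fun I hI => hI.unique η.continuous ?_ h1⟩
  exact fun p hp B L => det_pos_of_levelSetOrientation hk f p (hsurj p hp.1) B L

theorem formIntegral_eq {E : Type*} [NormedAddCommGroup E] [NormedSpace ℝ E] {k : ℕ} {M : Set E}
    {o : E → (Fin k → E) → Prop} {η : E → E [⋀^Fin k]→L[ℝ] ℝ} {I : ℝ}
    (hu : ∃! I, HasFormIntegral M o η I) (hI : HasFormIntegral M o η I) :
    formIntegral M o η = I := by
  rw [formIntegral, dif_pos hu.exists]
  exact hu.unique hu.exists.choose_spec hI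

theorem isAveragedLevelSetCurrent_averagedCurrent (hkpos : 0 < k) (hf : ContDiffOn ℝ ∞ f U)
    (hsurj : ∀ p ∈ U, Function.Surjective (fderiv ℝ f p)) (hΦ : Continuous Φ) :
    IsAveragedLevelSetCurrent hk U f Φ (averagedCurrent hk U f Φ) := by
  intro η
  have hu := existsUnique_hasFormIntegral_levelSet (hk := hk) hkpos hf hsurj η
  obtain ⟨N, e, ρ, he, hρ, hs, hsum⟩ := exists_fibreChart_partition hk hkpos hf hsurj
    η.hasCompactSupport η.tsupport_subset
  have hζ : ∀ i, tsupport (TestForm.mulLeft (ρ i) (hρ i) η) ⊆ (e i).source := fun i =>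
    (tsupport_smul_subset_left (ρ i) η).trans (hs i)
  have hI : ∀ i, Integrable fun y =>
      (∫ z, fibreIntegrand (e i) (TestForm.mulLeft (ρ i) (hρ i) η) (y, z)) * Φ y := fun i =>
    (he i).integrable_fibreIntegral (TestForm.mulLeft (ρ i) (hρ i) η).continuous
      (TestForm.mulLeft (ρ i) (hρ i) η).hasCompactSupport (hζ i) hΦ
  have heq : (fun y => formIntegral (levelSet U f y) (levelSetOrientation hk f) η * Φ y) =
      fun y => ∑ i, (∫ z, fibreIntegrand (e i) (TestForm.mulLeft (ρ i) (hρ i) η) (y, z)) * Φ y := by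
    ext y
    rw [formIntegral_eq (hu y) (hasFormIntegral_levelSet hf he hρ hs η hsum y), Finset.sum_mul]
  refine ⟨hu, ?_, ?_⟩
  · rw [heq]
    exact integrable_finsetSum _ fun i _ => hI i
  · rw [heq, integral_finsetSum _ fun i _ => hI i]
    conv_lhs => rw [← TestForm.sum_mulLeft ρ hρ η hsum, map_sum]
    exact Finset.sum_congr rfl fun i _ => (he i).averagedCurrent_apply hf hΦ (hζ i)

/-- The level sets of `f` have no boundary in `U`. -/
theorem averagedCurrent_d {m : ℕ} {hk : h + (m + 1) = 2 * n + 1} (hf : ContDiffOn ℝ ∞ f U)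
    (hsurj : ∀ p ∈ U, Function.Surjective (fderiv ℝ f p)) (hΦ : Continuous Φ)
    (η : TestForm U m) : averagedCurrent hk U f Φ (TestForm.d η) = 0 := by
  obtain ⟨N, e, ρ, he, hρ, hs, hsum⟩ := exists_fibreChart_partition hk m.succ_pos hf hsurj
    η.hasCompactSupport η.tsupport_subset
  rw [← TestForm.sum_mulLeft ρ hρ η hsum, map_sum, map_sum]
  refine Finset.sum_eq_zero fun i _ => ?_
  set ζ := TestForm.mulLeft (ρ i) (hρ i) η
  have hζs : tsupport ζ ⊆ (e i).source := (tsupport_smul_subset_left (ρ i) η).trans (hs i)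
  have hdζ : ⇑(TestForm.d ζ) = extDeriv ζ := funext fun p => TestForm.d_apply ζ p
  have hds : tsupport (TestForm.d ζ) ⊆ tsupport ζ := by
    refine closure_minimal (fun p hp => ?_) (isClosed_tsupport _)
    by_contra hc
    apply hp
    have h1 : (fun q => ζ q) =ᶠ[𝓝 p] fun _ => 0 :=
      notMem_tsupport_iff_eventuallyEq.1 hc
    rw [TestForm.d_apply, extDeriv, h1.fderiv_eq, fderiv_const_apply]
    exact map_zero (ContinuousAlternatingMap.alternatizeUncurryFinCLM ℝ (Heis n) ℝ)
  rw [(he i).averagedCurrent_apply hf hΦ (hds.trans hζs)]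
  -- The inner integral vanishes on every fibre separately, so `Φ` need not be differentiated.
  suffices h0 : ∀ y, ∫ z, fibreIntegrand (e i) (TestForm.d ζ) (y, z) = 0 by simp [h0]
  intro y
  rw [← (he i).setIntegral_fibre y, hdζ]
  refine setIntegral_extDeriv_coordFrame ((he i).isLocalParam y).isOpen
    ((he i).isLocalParam y).smooth ζ.contDiff (K := Prod.mk y ⁻¹' (e i '' tsupport ζ)) ?_ ?_ ?_
  · have hc : IsCompact (e i '' tsupport ζ) :=
      ζ.hasCompactSupport.isCompact.image_of_continuousOn ((e i).continuousOn.mono hζs)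
    refine (hc.image continuous_snd).of_isClosed_subset (hc.isClosed.preimage (by fun_prop)) ?_
    exact fun z hz => ⟨(y, z), hz, rfl⟩
  · rintro z ⟨p, hp, hpz⟩
    show (y, z) ∈ (e i).target
    rw [← hpz]
    exact (e i).map_source (hζs hp)
  · intro z hz hp
    exact ⟨_, hp, (e i).right_inv hz⟩

theorem boundary_averagedCurrent (hkpos : 0 < k) (hf : ContDiffOn ℝ ∞ f U)
    (hsurj : ∀ p ∈ U, Function.Surjective (fderiv ℝ f p)) (hΦ : Continuous Φ) :
    Current.boundary (averagedCurrent hk U f Φ) = 0 := by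
  obtain ⟨m, rfl⟩ : ∃ m, k = m + 1 := ⟨k - 1, by omega⟩
  exact ContinuousLinearMap.ext fun η => averagedCurrent_d hf hsurj hΦ η

end AveragedCurrent

/-! ### When the restriction of the averaged current by a form vanishes. -/

section Restriction

/-- A `k`-form on the `k`-dimensional kernel of `A` has a single coefficient, and the density is
that coefficient up to a nonzero determinant. -/
theorem fibreDensity_eq_zero_iff {N h k : ℕ} (hk : h + k = N) (hkpos : 0 < k)
    {A : EuclideanSpace ℝ (Fin N) →L[ℝ] EuclideanSpace ℝ (Fin h)} (hA : Function.Surjective A)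
    (η : EuclideanSpace ℝ (Fin N) [⋀^Fin k]→L[ℝ] ℝ) :
    fibreDensity hk A η = 0 ↔ ∀ v, (∀ i, A (v i) = 0) → η v = 0 := by
  constructor
  · intro h0 v hv
    choose u hu using fun i => hA (EuclideanSpace.single i (1 : ℝ))
    rw [apply_eq_detForm_mul_fibreDensity hk A η u v hu hv, h0, mul_zero]
  · intro H
    obtain ⟨L, hL, hdet⟩ := exists_positive_coordinates hk hkpos A hA
    have hL' : ∀ x, A (L.symm x) = x.1 := fun x => by rw [← hL, L.apply_symm_apply]
    have h1 := apply_eq_detForm_mul_fibreDensity hk A η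
      (fun i => L.symm.toContinuousLinearMap (stdFrame h i, 0))
      (fun j => L.symm.toContinuousLinearMap (0, stdFrame k j)) (fun i => hL' _) (fun j => hL' _)
    rw [H _ fun j => hL' _, detForm_joinFrame_eq_det] at h1
    exact (mul_eq_zero.1 h1.symm).resolve_left hdet.ne'

theorem exists_linearIndependent_extension {V : Type*} [AddCommGroup V] [Module ℝ V] {a b c : ℕ}
    (h : a + b = c) (hc : c ≤ Module.finrank ℝ V) {v : Fin a → V} (hv : LinearIndependent ℝ v) :
    ∃ w : Fin c → V, LinearIndependent ℝ w ∧ ∀ i, w (Fin.cast h (Fin.castAdd b i)) = v i := by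
  induction b generalizing c with
  | zero =>
    subst h
    exact ⟨v, hv, fun i => rfl⟩
  | succ b ih =>
    subst h
    obtain ⟨w, hw, hwv⟩ := ih rfl (by omega)
    obtain ⟨x, hx⟩ := exists_linearIndependent_snoc_of_lt_finrank hw (by omega)
    refine ⟨Fin.snoc w x, hx, fun i => ?_⟩
    rw [← hwv i]
    exact Fin.snoc_castSucc (α := fun _ => V) x w (Fin.castAdd b i)

variable {n h k : ℕ} {hk : h + k = 2 * n + 1} {U : TopologicalSpace.Opens (Heis n)}
  {f : Heis n → EuclideanSpace ℝ (Fin h)} {Φ : EuclideanSpace ℝ (Fin h) → ℝ}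

theorem finrank_ker_of_surjective (hk : h + k = 2 * n + 1)
    {A : Heis n →L[ℝ] EuclideanSpace ℝ (Fin h)} (hA : Function.Surjective A) :
    Module.finrank ℝ (LinearMap.ker A.toLinearMap) = k := by
  have h1 := LinearMap.finrank_range_add_finrank_ker A.toLinearMap
  rw [LinearMap.range_eq_top.2 hA, finrank_top, finrank_euclideanSpace_fin,
    finrank_euclideanSpace_fin] at h1
  omega

/-- Testing on `g β` with `g` an arbitrary smooth cut-off and `β` constant, the fundamental lemma of
the calculus of variations gives vanishing almost everywhere, and continuity upgrades it to every
point of `U`. -/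
theorem fibreDensity_wedge_eq_zero (hf : ContDiffOn ℝ ∞ f U) (hΦ : Continuous Φ) {a b : ℕ}
    (hab : a + b = k) {χ : Heis n → Heis n [⋀^Fin a]→L[ℝ] ℝ} (hχ : ContDiff ℝ ∞ χ)
    (H : Current.RestrictEqZero (averagedCurrent hk U f Φ) χ hχ) {p : Heis n} (hp : p ∈ U)
    (β : Heis n [⋀^Fin b]→L[ℝ] ℝ) :
    Φ (f p) * fibreDensity hk (fderiv ℝ f p) (wedge hab (χ p) β) = 0 := by
  set G : Heis n → ℝ := fun q => Φ (f q) * fibreDensity hk (fderiv ℝ f q) (wedge hab (χ q) β)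
  have hG : ContinuousOn G U := by
    have h1 : Continuous fun q => wedge hab (χ q) β :=
      (contDiff_wedge hab hχ (contDiff_const (c := β))).continuous
    exact (continuousOn_density hk hf hΦ).clm_apply h1.continuousOn
  have h0 : ∀ᵐ q, q ∈ (U : Set (Heis n)) → G q = 0 := by
    refine U.isOpen.ae_eq_zero_of_integral_contDiff_smul_eq_zero
      (hG.locallyIntegrableOn U.isOpen.measurableSet) fun g hg hgc hgs => ?_
    let η : TestForm U b :=
      { toFun := fun q => g q • β
        contDiff' := hg.smul contDiff_const
        hasCompactSupport' := hgc.smul_right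
        tsupport_subset' := (tsupport_smul_subset_left g fun _ => β).trans hgs }
    have h1 := H b hab η
    rw [averagedCurrent_apply hk hf hΦ] at h1
    rw [← h1]
    congr 1
    ext q
    have h2 : TestForm.wedgeLeft hab χ hχ η q = g q • wedge hab (χ q) β :=
      (wedgeL hab (χ q)).map_smul (g q) β
    rw [h2, map_smul]
    simp only [G, smul_eq_mul]
    ring
  exact Measure.eqOn_open_of_ae_eq ((ae_restrict_iff' U.isOpen.measurableSet).2 h0) U.isOpen hG
    continuousOn_const hp

/-- `T_{f,Φ} ⌞ χ` vanishes if and only if `χ` vanishes on the level sets where `Φ ≠ 0`. -/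
theorem restrictEqZero_averagedCurrent_iff (hkpos : 0 < k) (hf : ContDiffOn ℝ ∞ f U)
    (hsurj : ∀ p ∈ U, Function.Surjective (fderiv ℝ f p)) (hΦ : Continuous Φ) {a : ℕ}
    {χ : Heis n → Heis n [⋀^Fin a]→L[ℝ] ℝ} (hχ : ContDiff ℝ ∞ χ) :
    Current.RestrictEqZero (averagedCurrent hk U f Φ) χ hχ ↔
      ∀ p ∈ U, Φ (f p) ≠ 0 → ∀ v, (∀ i, fderiv ℝ f p (v i) = 0) → χ p v = 0 := by
  constructor
  · intro H p hp hΦp v hv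
    by_cases hli : LinearIndependent ℝ v
    swap
    · exact (χ p).toAlternatingMap.map_linearDependent v hli
    have hfin := finrank_ker_of_surjective hk (hsurj p hp)
    let v' : Fin a → LinearMap.ker (fderiv ℝ f p).toLinearMap := fun i => ⟨v i, hv i⟩
    have hv' : LinearIndependent ℝ v' :=
      LinearIndependent.of_comp (LinearMap.ker (fderiv ℝ f p).toLinearMap).subtype hli
    have hak : a ≤ k := by
      have := hv'.fintype_card_le_finrank
      rwa [hfin, Fintype.card_fin] at this
    obtain ⟨b, hab⟩ := Nat.exists_eq_add_of_le hak
    -- Complete `v` to a basis `w` of `ker df_p` and take `β` equal to `1` on the added vectors and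
    -- killed by `v`; then `(χ ∧ β)(w) = χ(v)`.
    obtain ⟨w, hw, hwv⟩ := exists_linearIndependent_extension hab.symm hfin.ge hv'
    have hw' : LinearIndependent ℝ fun i => (w i : Heis n) :=
      hw.map' _ (Submodule.ker_subtype _)
    obtain ⟨β, hβ1, hβ0⟩ := exists_dual_form hab.symm hw'
    have h1 := fibreDensity_wedge_eq_zero hf hΦ hab.symm hχ H hp β
    have h2 := (fibreDensity_eq_zero_iff hk hkpos (hsurj p hp) _).1
      ((mul_eq_zero.1 h1).resolve_left hΦp) (fun i => (w i : Heis n)) fun i => (w i).2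
    rw [wedge_eq_mul_of_right hab.symm _ _ _ fun t i j hij _ => hβ0 t i j hij, hβ1, mul_one] at h2
    rw [← h2]
    congr 1
    ext1 i
    rw [hwv i]
  · intro H b hab η
    rw [averagedCurrent_apply hk hf hΦ]
    refine integral_eq_zero_of_ae (Eventually.of_forall fun p => ?_)
    show Φ (f p) * fibreDensity hk (fderiv ℝ f p) (wedge hab (χ p) (η p)) = 0
    by_cases hp : p ∈ U
    · by_cases hΦp : Φ (f p) = 0
      · rw [hΦp, zero_mul]
      · rw [(fibreDensity_eq_zero_iff hk hkpos (hsurj p hp) _).2, mul_zero]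
        intro v hv
        exact wedge_eq_zero_of_terms hab _ _ _ fun σ => Or.inl (H p hp hΦp _ fun i => hv _)
    · have h0 : η p = 0 := image_eq_zero_of_notMem_tsupport fun hc => hp (η.tsupport_subset hc)
      rw [h0, ← wedgeL_apply, map_zero, map_zero, mul_zero]

end Restriction

/-! ### From the vanishing of `θ ∧ (dθ)^{k-n}` to co-Legendrian level sets. -/

section Main

variable {n h k : ℕ} {U : TopologicalSpace.Opens (Heis n)}
  {f : Heis n → EuclideanSpace ℝ (Fin h)}

theorem contactPow_apply_of_transverse {m : ℕ} (p w : Heis n) (hw : contactCovector n p w = 1)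
    (l : Fin (2 * m) → Heis n) (hl : ∀ i, contactCovector n p (l i) = 0) :
    contactPow n m p (joinFrame rfl (fun _ : Fin 1 => w) l) = dContactPow n m p l := by
  have hθ : ∀ t : Fin 1 → Heis n, contactForm n p t = contactCovector n p (t 0) := fun t => rfl
  rw [contactPow, wedge_eq_mul_of_left]
  · rw [hθ, joinFrame_left, hw, one_mul]
    congr 1
    ext1 i
    rw [joinFrame_right]
  · intro t i j hij _
    rw [joinFrame_right] at hij
    rw [hθ, Subsingleton.elim 0 i, hij, hl]

/-- The form `θ ∧ (dθ)^{k-n}` vanishes on a `k`-dimensional subspace transverse to `ker θ_p` if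
and only if the subspace meets `ker θ_p` in a coisotropic subspace. -/
theorem contactPow_eq_zero_iff_coisotropic (hnk : n + 1 ≤ k) (p : Heis n)
    (K : Submodule ℝ (Heis n)) (hdim : Module.finrank ℝ K = k) (w : Heis n) (hw : w ∈ K)
    (hw1 : contactCovector n p w = 1) :
    (∀ v : Fin (1 + 2 * (k - n)) → Heis n, (∀ i, v i ∈ K) → contactPow n (k - n) p v = 0) ↔
      contactOrthogonal p (K ⊓ LinearMap.ker (contactCovector n p : Heis n →ₗ[ℝ] ℝ)) ≤ K := by
  constructor
  · intro H
    set L := K ⊓ LinearMap.ker (contactCovector n p : Heis n →ₗ[ℝ] ℝ) with hL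
    refine (contactOrthogonal_le_of_dContactPow_eq_zero hnk p L (fun v hv => hv.2) ?_
      fun v hv => ?_).trans inf_le_left
    · have h1 := LinearMap.finrank_range_add_finrank_ker
        ((contactCovector n p : Heis n →ₗ[ℝ] ℝ).domRestrict K)
      have h2 : LinearMap.range ((contactCovector n p : Heis n →ₗ[ℝ] ℝ).domRestrict K) = ⊤ := by
        refine LinearMap.range_eq_top.2 fun c => ⟨c • ⟨w, hw⟩, ?_⟩
        rw [map_smul]
        show c • contactCovector n p w = c
        rw [hw1, smul_eq_mul, mul_one]
      have h3 : Module.finrank ℝ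
          (LinearMap.ker ((contactCovector n p : Heis n →ₗ[ℝ] ℝ).domRestrict K)) =
          Module.finrank ℝ L := by
        rw [LinearMap.ker_domRestrict, ← Submodule.finrank_map_subtype_eq,
          Submodule.map_comap_subtype]
      rw [h2, finrank_top, Module.finrank_self] at h1
      omega
    · rw [← contactPow_apply_of_transverse p w hw1 v fun i => (hv i).2]
      refine H _ fun i => ?_
      refine Fin.addCases (fun i => ?_) (fun i => ?_) i
      · have := joinFrame_left rfl (fun _ : Fin 1 => w) v i
        rw [Fin.cast_eq_self] at this
        rwa [this]
      · have := joinFrame_right rfl (fun _ : Fin 1 => w) v i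
        rw [Fin.cast_eq_self] at this
        rw [this]
        exact (hv i).1
  · exact fun H v hv => contactPow_eq_zero_of_coisotropic hnk p K hdim w hw hw1 H v hv

theorem isCoLegendrian_levelSet_iff (hk : h + k = 2 * n + 1) (hnk : n + 1 ≤ k)
    (hf : ContDiffOn ℝ ∞ f U)
    (hsub : ∀ p ∈ U, ∀ z : EuclideanSpace ℝ (Fin h),
      ∃ v : Heis n, contactCovector n p v = 0 ∧ fderiv ℝ f p v = z)
    (y : EuclideanSpace ℝ (Fin h)) :
    IsCoLegendrian k (levelSet U f y) ↔ ∀ p ∈ U, f p = y → ∀ v : Fin (1 + 2 * (k - n)) → Heis n,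
      (∀ i, fderiv ℝ f p (v i) = 0) → contactPow n (k - n) p v = 0 := by
  have hkpos : 0 < k := by omega
  have hsurj : ∀ p ∈ U, Function.Surjective (fderiv ℝ f p) := fun p hp z =>
    (hsub p hp z).imp fun v hv => hv.2
  rw [IsCoLegendrian, and_iff_right (isSubmanifold_levelSet hk hkpos hf hsurj y)]
  have key : ∀ p ∈ U, (∀ v : Fin (1 + 2 * (k - n)) → Heis n,
      (∀ i, fderiv ℝ f p (v i) = 0) → contactPow n (k - n) p v = 0) ↔
      contactOrthogonal p (LinearMap.ker (fderiv ℝ f p).toLinearMap ⊓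
        LinearMap.ker (contactCovector n p : Heis n →ₗ[ℝ] ℝ)) ≤
        LinearMap.ker (fderiv ℝ f p).toLinearMap := by
    intro p hp
    -- Surjectivity of `df_p` on `ker θ_p` gives a horizontal `v` with `df_p(v) = df_p(∂_t)`; then
    -- `∂_t - v` lies in `ker df_p` and `θ` takes the value `1` on it.
    obtain ⟨v, hv0, hv⟩ := hsub p hp
      (fderiv ℝ f p (EuclideanSpace.single (Fin.last (2 * n)) 1))
    refine contactPow_eq_zero_iff_coisotropic hnk p _ (finrank_ker_of_surjective hk (hsurj p hp))
      (EuclideanSpace.single (Fin.last (2 * n)) 1 - v) ?_ ?_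
    · show fderiv ℝ f p _ = 0
      rw [map_sub, hv, sub_self]
    · rw [map_sub, hv0, contactCovector_apply_last, sub_zero]
  constructor
  · intro H p hp hpy
    rw [key p hp]
    intro w hw
    subst hpy
    exact (tangentVectors_levelSet hk hkpos hf hsurj hp w).1 (H p ⟨hp, rfl⟩ w hw.1
      fun v hv hv' => hw.2 v ⟨(tangentVectors_levelSet hk hkpos hf hsurj hp v).1 hv, hv'⟩)
  · rintro H p ⟨hp, rfl⟩ w hw hw'
    refine (tangentVectors_levelSet hk hkpos hf hsurj hp w).2
      ((key p hp).1 (H p hp rfl) ⟨hw, fun v hv => ?_⟩)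
    exact hw' v ((tangentVectors_levelSet hk hkpos hf hsurj hp v).2 hv.1) hv.2

end Main

end Heisenberg

end

theorem mainTheorem8 (n k h : ℕ) (hnk : n + 1 ≤ k) (hk : h + k = 2 * n + 1)
    (U : TopologicalSpace.Opens (Heisenberg.Heis n))
    (f : Heisenberg.Heis n → EuclideanSpace ℝ (Fin h)) (hf : ContDiffOn ℝ ∞ f U)
    (hsub : ∀ p ∈ U, ∀ z : EuclideanSpace ℝ (Fin h),
      ∃ v : Heisenberg.Heis n, Heisenberg.contactCovector n p v = 0 ∧ fderiv ℝ f p v = z)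
    (Φ : EuclideanSpace ℝ (Fin h) → ℝ) (hΦ : ContDiff ℝ ∞ Φ) :
    ∃ T : Heisenberg.Current U k, Heisenberg.IsAveragedLevelSetCurrent hk U f Φ T ∧
      (Heisenberg.IsOblique T ↔
        ∀ y, Φ y ≠ 0 → Heisenberg.IsCoLegendrian k (Heisenberg.levelSet U f y)) := by
  have hkpos : 0 < k := by omega
  have hsurj : ∀ p ∈ U, Function.Surjective (fderiv ℝ f p) := fun p hp z =>
    (hsub p hp z).imp fun v hv => hv.2
  refine ⟨Heisenberg.averagedCurrent hk U f Φ,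
    Heisenberg.isAveragedLevelSetCurrent_averagedCurrent hkpos hf hsurj hΦ.continuous, ?_⟩
  -- The boundary is zero, so its half of the oblique condition is automatic.
  have h1 : Heisenberg.IsCoLegendrianCurrent
      (Heisenberg.Current.boundary (Heisenberg.averagedCurrent hk U f Φ)) := by
    rw [Heisenberg.boundary_averagedCurrent hkpos hf hsurj hΦ.continuous]
    exact fun b hb η => rfl
  rw [Heisenberg.IsOblique, and_iff_left h1, Heisenberg.IsCoLegendrianCurrent,
    Heisenberg.restrictEqZero_averagedCurrent_iff hkpos hf hsurj hΦ.continuous]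
  simp only [Heisenberg.isCoLegendrian_levelSet_iff hk hnk hf hsub]
  exact ⟨fun H y hy p hp hpy => H p hp (hpy ▸ hy), fun H p hp hΦp => H _ hΦp p hp rfl⟩
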